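/- Let $\Bbbk$ be a field of odd characteristic $p$, let $0<t<\theta$ be integers, let $\mathfrak q=(q_{ij})_{1\le i,j\le\theta}$ and $\mathfrak q'=(q'_{ij})_{1\le i,j\le\theta}$ be matrices with entries in $\Bbbk^\times$ such that $q_{ii}=q'_{ii}=1$ and $q_{ij}q_{ji}=q'_{ij}q'_{ji}=1$ for all $i,j$, and let $\mathbf a=(a_{ij})_{t<i\le\theta,\,1\le j\le t}$ be a family of elements of $\mathbb F_p\subseteq\Bbbk$. For $1\le i\le\theta$, $1\le j\le t$ put $s_{ij}=a_{ij}$ if $i>t$, $s_{jj}=1$, and $s_{ij}=0$ if $i\le t$, $i\ne j$. Let $\mathcal V(\mathfrak q,\mathbf a)$ be the vector space with basis $x_i$ $(1\le i\le\theta)$, $y_j$ $(1\le j\le t)$ and the braiding $$c(x_i\otimes x_j)=q_{ij}\,x_j\otimes x_i,\quad c(y_i\otimes x_j)=q_{ij}\,x_j\otimes y_i,\quad c(x_i\otimes y_j)=q_{ij}(y_j+s_{ij}x_j)\otimes x_i,\quad c(y_i\otimes y_j)=q_{ij}(y_j+s_{ij}x_j)\otimes y_i .$$ Let $f$ be a positive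 integer such that $p$ and the orders of all $q_{ij}$ and all $q'_{ij}$ divide $f$, and let $\Gamma=(\mathbb Z/f)^\theta$ with canonical generators $g_1,\dots,g_\theta$, written multiplicatively. Then the following hold. (a) The braided vector spaces $\mathcal V(\mathfrak q,\mathbf a)$ and $\mathcal V(\mathfrak q',\mathbf a)$ are realizable in the category of Yetter–Drinfeld modules over $\Bbbk\Gamma$ (that is, each carries a Yetter–Drinfeld module structure whose braiding is the given one). Such a structure on $\mathcal V(\mathfrak q,\mathbf a)$ is given by $\deg x_i=g_i$, $\deg y_j=g_j$, $g_i\cdot x_j=q_{ij}x_j$, $g_i\cdot y_j=q_{ij}(y_j+s_{ij}x_j)$, and similarly for $\mathfrak q'$. (b) With respect to these structures, let $\mathfrak B(\mathcal V)$ denote the Nichols algebra of $\mathcal V$: the quotient of the tensor algebra $T(\mathcal V)$ by the sum of all two-sided ideals that are generated by homogeneous elements of degrees $\ge2$, are Yetter–Drinfeld submodules and are coideals. There is a bilinear form $\sigma:\Gamma\times\Gamma\to\Bbbk^\times$ with $\sigma(g_i,g_j)=q'_{ij}q_{ij}^{-1}$ for $i\le j$ and $\sigma(g_i,g_j)=1$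 for $i>j$; its linear extension $\Bbbk\Gamma\otimes\Bbbk\Gamma\to\Bbbk$ is an invertible 2-cocycle; and $\mathfrak B(\mathcal V(\mathfrak q',\mathbf a))$ is isomorphic to $\mathfrak B(\mathcal V(\mathfrak q,\mathbf a))_\sigma$ as Hopf algebras in the category of Yetter–Drinfeld modules over $\Bbbk\Gamma$. Here, for a Hopf algebra $R$ in this category, $R_\sigma$ is the Hopf algebra in the same category with $R_\sigma\#\Bbbk\Gamma\simeq(R\#\Bbbk\Gamma)_{\sigma(\pi\otimes\pi)}$ (cocycle deformation of the bosonization, $\pi:R\#\Bbbk\Gamma\to\Bbbk\Gamma$ the projection). Explicitly, $R_\sigma=R$ as $\Gamma$-graded vector space, with the same unit and counit, and, for $x\in R_g$, $y\in R_h$, with action $g'\rightharpoonup_\sigma x=\sigma(g',g)\sigma(g,g')^{-1}\,g'\cdot x$, multiplication $x\cdot_\sigma y=\sigma(g,h)\,xy$, and comultiplication obtained from that of $R$ by multiplying its component in $R_g\otimes R_h$ by $\sigma(g,h)^{-1}$. Moreover $\mathfrak B(\mathcal V(\mathfrak q,\mathbf a))$, $\mathfrak B(\mathcal V(\mathfrak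 q',\mathbf a))$ and $\mathfrak B(\mathcal V(\mathfrak q,\mathbf a))_\sigma$ are Hopf algebras in this category (with bijective antipode). -/

import Mathlib

open scoped TensorProduct

noncomputable section

namespace BraidedHopf

/-! ### Yetter-Drinfeld modules over the group algebra of an abelian group -/

/-- The data of a Yetter-Drinfeld module over `kΓ`, for an abelian group `Γ`: operators `act g`
(the action of `g ∈ Γ`) and a coaction `V → kΓ ⊗ V`. The component `V_g` of degree `g` is
`{v | coact v = g ⊗ v}`. The axioms are in `YDData.IsYD`. -/
structure YDData (k Γ V : Type*) [Field k] [CommGroup Γ] [AddCommGroup V] [Module k V] where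
  act : Γ → Module.End k V
  coact : V →ₗ[k] MonoidAlgebra k Γ ⊗[k] V

namespace YDData

variable {k Γ V W : Type*} [Field k] [CommGroup Γ] [AddCommGroup V] [Module k V]
  [AddCommGroup W] [Module k W]

/-- `M` is a Yetter-Drinfeld module over `kΓ`: a module and a comodule over `kΓ` such that the
action preserves the components (this is the Yetter-Drinfeld condition as `Γ` is abelian). -/
structure IsYD (M : YDData k Γ V) : Prop where
  act_one : M.act 1 = LinearMap.id
  act_mul : ∀ g h : Γ, M.act (g * h) = M.act g ∘ₗ M.act h
  coassoc : (TensorProduct.assoc k (MonoidAlgebra k Γ) (MonoidAlgebra k Γ) V).toLinearMap ∘ₗ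
      (Coalgebra.comul (R := k) (A := MonoidAlgebra k Γ)).rTensor V ∘ₗ M.coact =
    M.coact.lTensor (MonoidAlgebra k Γ) ∘ₗ M.coact
  counit_coact : (TensorProduct.lid k V).toLinearMap ∘ₗ
      (Coalgebra.counit (R := k) (A := MonoidAlgebra k Γ)).rTensor V ∘ₗ M.coact = LinearMap.id
  compat : ∀ g : Γ, M.coact ∘ₗ M.act g = (M.act g).lTensor (MonoidAlgebra k Γ) ∘ₗ M.coact

/-- The linear extension `kΓ → End V` of the action. -/
def actLin (M : YDData k Γ V) : MonoidAlgebra k Γ →ₗ[k] Module.End k V :=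
  Finsupp.linearCombination k M.act ∘ₗ (MonoidAlgebra.coeffLinearEquiv k).toLinearMap

/-- The map `c : V ⊗ W → W ⊗ V`, `c (v ⊗ w) = v₍₋₁₎ • w ⊗ v₍₀₎`, that is,
`c (v ⊗ w) = g • w ⊗ v` for `v` of degree `g`. -/
def braiding (M : YDData k Γ V) (N : YDData k Γ W) : V ⊗[k] W →ₗ[k] W ⊗[k] V :=
  (TensorProduct.lift N.actLin).rTensor V ∘ₗ
    (TensorProduct.rightComm k (MonoidAlgebra k Γ) V W).toLinearMap ∘ₗ M.coact.rTensor W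

/-- The tensor product: diagonal action, codiagonal coaction. -/
def tensor (M : YDData k Γ V) (N : YDData k Γ W) : YDData k Γ (V ⊗[k] W) where
  act g := TensorProduct.map (M.act g) (N.act g)
  coact := (LinearMap.mul' k (MonoidAlgebra k Γ)).rTensor (V ⊗[k] W) ∘ₗ
    (TensorProduct.tensorTensorTensorComm k (MonoidAlgebra k Γ) V
      (MonoidAlgebra k Γ) W).toLinearMap ∘ₗ TensorProduct.map M.coact N.coact

/-- The unit object `k`: trivial action, concentrated in degree `1`. -/
def unit (k Γ : Type*) [Field k] [CommGroup Γ] : YDData k Γ k where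
  act _ := LinearMap.id
  coact := TensorProduct.mk k (MonoidAlgebra k Γ) k 1

/-- `f` is a morphism of Yetter-Drinfeld modules. -/
def IsHom (M : YDData k Γ V) (N : YDData k Γ W) (f : V →ₗ[k] W) : Prop :=
  (∀ g : Γ, f ∘ₗ M.act g = N.act g ∘ₗ f) ∧
    N.coact ∘ₗ f = f.lTensor (MonoidAlgebra k Γ) ∘ₗ M.coact

/-- The multiplication of the braided tensor product `R ⊗ R` induced by a multiplication `m`
of `R`: it is `(m ⊗ m) (id ⊗ c ⊗ id)`, so that
`(a ⊗ b) (a' ⊗ b') = a (b₍₋₁₎ • a') ⊗ b₍₀₎ b'`. -/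
def tensorMul (M : YDData k Γ V) (m : V ⊗[k] V →ₗ[k] V) :
    (V ⊗[k] V) ⊗[k] (V ⊗[k] V) →ₗ[k] V ⊗[k] V :=
  TensorProduct.map m m ∘ₗ
    (TensorProduct.assoc k V V (V ⊗[k] V)).symm.toLinearMap ∘ₗ
    ((TensorProduct.assoc k V V V).toLinearMap ∘ₗ
      (M.braiding M).rTensor V ∘ₗ
      (TensorProduct.assoc k V V V).symm.toLinearMap).lTensor V ∘ₗ
    (TensorProduct.assoc k V V (V ⊗[k] V)).toLinearMap

end YDData

/-- A braided vector space `(V, c)` is realizable in the category of Yetter-Drinfeld modules over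
`kΓ` if `V` has such a structure whose braiding is `c`. -/
def Realizable {k V : Type*} (Γ : Type*) [Field k] [CommGroup Γ] [AddCommGroup V] [Module k V]
    (c : V ⊗[k] V →ₗ[k] V ⊗[k] V) : Prop :=
  ∃ M : YDData k Γ V, M.IsYD ∧ M.braiding M = c

/-! ### Hopf algebras in the category of Yetter-Drinfeld modules -/

/-- The data (without axioms) of a Hopf algebra in the category of Yetter-Drinfeld modules over
`kΓ`. The axioms are in `HopfData.IsHopf`; the antipode is determined by the rest. -/
structure HopfData (k Γ R : Type*) [Field k] [CommGroup Γ] [AddCommGroup R] [Module k R] extends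
    YDData k Γ R where
  mul : R ⊗[k] R →ₗ[k] R
  one : R
  comul : R →ₗ[k] R ⊗[k] R
  counit : R →ₗ[k] k

namespace HopfData

variable {k Γ R S : Type*} [Field k] [CommGroup Γ] [AddCommGroup R] [Module k R]
  [AddCommGroup S] [Module k S]

/-- `A` is a Hopf algebra (with bijective antipode) in the braided category of Yetter-Drinfeld
modules over `kΓ`. -/
structure IsHopf (A : HopfData k Γ R) : Prop where
  isYD : A.toYDData.IsYD
  mul_assoc : ∀ x y z : R, A.mul (A.mul (x ⊗ₜ y) ⊗ₜ z) = A.mul (x ⊗ₜ A.mul (y ⊗ₜ z))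
  one_mul : ∀ x : R, A.mul (A.one ⊗ₜ x) = x
  mul_one : ∀ x : R, A.mul (x ⊗ₜ A.one) = x
  mul_hom : (A.toYDData.tensor A.toYDData).IsHom A.toYDData A.mul
  one_hom : (YDData.unit k Γ).IsHom A.toYDData (LinearMap.toSpanSingleton k R A.one)
  coassoc : (TensorProduct.assoc k R R R).toLinearMap ∘ₗ A.comul.rTensor R ∘ₗ A.comul =
    A.comul.lTensor R ∘ₗ A.comul
  counit_left : (TensorProduct.lid k R).toLinearMap ∘ₗ A.counit.rTensor R ∘ₗ A.comul =
    LinearMap.id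
  counit_right : (TensorProduct.rid k R).toLinearMap ∘ₗ A.counit.lTensor R ∘ₗ A.comul =
    LinearMap.id
  comul_hom : A.toYDData.IsHom (A.toYDData.tensor A.toYDData) A.comul
  counit_hom : A.toYDData.IsHom (YDData.unit k Γ) A.counit
  comul_mul : ∀ x y : R, A.comul (A.mul (x ⊗ₜ y)) =
    A.toYDData.tensorMul A.mul (A.comul x ⊗ₜ A.comul y)
  comul_one : A.comul A.one = A.one ⊗ₜ A.one
  counit_mul : ∀ x y : R, A.counit (A.mul (x ⊗ₜ y)) = A.counit x * A.counit y
  counit_one : A.counit A.one = 1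
  antipode : ∃ s : R →ₗ[k] R, Function.Bijective s ∧ A.toYDData.IsHom A.toYDData s ∧
    (∀ x : R, A.mul (s.rTensor R (A.comul x)) = A.counit x • A.one) ∧
    (∀ x : R, A.mul (s.lTensor R (A.comul x)) = A.counit x • A.one)

/-- `A` and `B` are isomorphic as Hopf algebras in the category of Yetter-Drinfeld modules: there
is a linear bijection compatible with action, coaction, multiplication, unit, comultiplication
and counit. -/
def Isomorphic (A : HopfData k Γ R) (B : HopfData k Γ S) : Prop :=
  ∃ e : R ≃ₗ[k] S, A.toYDData.IsHom B.toYDData e.toLinearMap ∧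
    (∀ x y : R, e (A.mul (x ⊗ₜ y)) = B.mul (e x ⊗ₜ e y)) ∧
    e A.one = B.one ∧
    (∀ x : R, B.comul (e x) = TensorProduct.map e.toLinearMap e.toLinearMap (A.comul x)) ∧
    (∀ x : R, B.counit (e x) = A.counit x)

end HopfData

/-! ### Cocycles and twisting -/

section Cocycle

variable {k : Type*} [Field k]

/-- `σ : H ⊗ H → k` is an invertible (normalized) 2-cocycle on the Hopf algebra `H`: it is
invertible for the convolution product, `σ(x, 1) = ε(x) = σ(1, x)`, and
`σ(x₁, y₁) σ(x₂ y₂, z) = σ(y₁, z₁) σ(x, y₂ z₂)`. The latter is an identity of convolution products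
of maps `H ⊗ (H ⊗ H) → k`. -/
def IsInvertibleTwoCocycle {H : Type*} [Ring H] [HopfAlgebra k H] (σ : H ⊗[k] H →ₗ[k] k) : Prop :=
  IsUnit (WithConv.toConv σ) ∧
  (∀ x : H, σ (x ⊗ₜ 1) = Coalgebra.counit (R := k) x) ∧
  (∀ x : H, σ (1 ⊗ₜ x) = Coalgebra.counit (R := k) x) ∧
  WithConv.toConv (LinearMap.mul' k k ∘ₗ
      TensorProduct.map σ (Coalgebra.counit (R := k) (A := H)) ∘ₗ
      (TensorProduct.assoc k H H H).symm.toLinearMap) *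
    WithConv.toConv (σ ∘ₗ (LinearMap.mul' k H).rTensor H ∘ₗ
      (TensorProduct.assoc k H H H).symm.toLinearMap) =
  WithConv.toConv (LinearMap.mul' k k ∘ₗ
      TensorProduct.map (Coalgebra.counit (R := k) (A := H)) σ) *
    WithConv.toConv (σ ∘ₗ (LinearMap.mul' k H).lTensor H)

variable {Γ : Type*} [CommGroup Γ]

/-- The linear extension `kΓ → k` of a function `Γ → kˣ`. -/
def linExt (χ : Γ → kˣ) : MonoidAlgebra k Γ →ₗ[k] k :=
  Finsupp.linearCombination k (fun g => (χ g : k)) ∘ₗ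
    (MonoidAlgebra.coeffLinearEquiv k).toLinearMap

/-- The linear extension `kΓ ⊗ kΓ → k` of a bilinear form `σ : Γ × Γ → kˣ`. -/
def bilinExt (σ : Γ →* Γ →* kˣ) : MonoidAlgebra k Γ ⊗[k] MonoidAlgebra k Γ →ₗ[k] k :=
  TensorProduct.lift
    (Finsupp.linearCombination k (fun g => linExt (fun h => σ g h)) ∘ₗ
      (MonoidAlgebra.coeffLinearEquiv k).toLinearMap)

/-- The map `x ⊗ y ↦ σ(x₍₋₁₎, y₍₋₁₎) x₍₀₎ ⊗ y₍₀₎`, i.e. multiplication by `σ(g, h)` on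
`V_g ⊗ V_h`. -/
def YDData.scale {V : Type*} [AddCommGroup V] [Module k V] (M : YDData k Γ V)
    (σ : Γ →* Γ →* kˣ) : V ⊗[k] V →ₗ[k] V ⊗[k] V :=
  (TensorProduct.lid k (V ⊗[k] V)).toLinearMap ∘ₗ (bilinExt σ).rTensor (V ⊗[k] V) ∘ₗ
    (TensorProduct.tensorTensorTensorComm k (MonoidAlgebra k Γ) V
      (MonoidAlgebra k Γ) V).toLinearMap ∘ₗ TensorProduct.map M.coact M.coact

/-- The twist `A_σ` of a Hopf algebra `A` in Yetter-Drinfeld modules over `kΓ` by a bilinear form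
`σ : Γ × Γ → kˣ`, viewed as a 2-cocycle on `kΓ`. It is the Hopf algebra in Yetter-Drinfeld modules
over `(kΓ)_σ = kΓ` such that `(A # kΓ)_σ = A_σ # kΓ`, where `(A # kΓ)_σ` has the comultiplication
of the bosonization `A # kΓ` and its multiplication deformed by the cocycle `σ(π ⊗ π)`, `π` being
the projection `A # kΓ → kΓ`. Explicitly, `A_σ = A` as a comodule, with the same unit and counit;
for `x` of degree `g` and `y` of degree `h`
* the action is `g' ⇀ x = σ(g', g) σ(g, g')⁻¹ (g' • x)`;
* the multiplication is `x ⬝ y = σ(g, h) x y`;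
* the comultiplication is `Δ` followed by multiplication by `σ(g, h)⁻¹` on `A_g ⊗ A_h`.
The last item expresses that the comultiplication of `A # kΓ` is not changed: it is
`x ↦ x¹ (x²)₍₋₁₎ ⊗ (x²)₍₀₎`, where `Δ x = x¹ ⊗ x²`, and the deformed product of `x¹ ∈ A_g` and
`h ∈ Γ` is `σ(g, h) x¹ h`. -/
def HopfData.twist {R : Type*} [AddCommGroup R] [Module k R] (A : HopfData k Γ R)
    (σ : Γ →* Γ →* kˣ) : HopfData k Γ R where
  act g := A.act g ∘ₗ (TensorProduct.lid k R).toLinearMap ∘ₗ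
    (linExt (fun h => σ g h * (σ h g)⁻¹)).rTensor R ∘ₗ A.coact
  coact := A.coact
  mul := A.mul ∘ₗ A.toYDData.scale σ
  one := A.one
  comul := A.toYDData.scale σ⁻¹ ∘ₗ A.comul
  counit := A.counit

end Cocycle

/-! ### The Nichols algebra of a Yetter-Drinfeld module -/

section Nichols

variable {k Γ V : Type*} [Field k] [CommGroup Γ] [AddCommGroup V] [Module k V]

namespace YDData

/-- The Yetter-Drinfeld structure on the tensor algebra `T(V)`: `Γ` acts by algebra automorphisms,
the coaction is an algebra map, and both extend those of `V`. -/
def tensorAlgebra (M : YDData k Γ V) : YDData k Γ (TensorAlgebra k V) where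
  act g := (TensorAlgebra.lift k (TensorAlgebra.ι k ∘ₗ M.act g)).toLinearMap
  coact := (TensorAlgebra.lift k
    ((TensorAlgebra.ι k (M := V)).lTensor (MonoidAlgebra k Γ) ∘ₗ M.coact)).toLinearMap

/-- The comultiplication of `T(V)`: the algebra map from `T(V)` to the braided tensor product
`T(V) ⊗ T(V)` with `v ↦ v ⊗ 1 + 1 ⊗ v` for `v ∈ V`. Thus `Δ(v₁ ⋯ vₙ)` is obtained from `1 ⊗ 1` by
multiplying successively on the left by `vᵢ ⊗ 1 + 1 ⊗ vᵢ`, `i = n, …, 1`. -/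
def tensorComul (M : YDData k Γ V) :
    TensorAlgebra k V →ₗ[k] TensorAlgebra k V ⊗[k] TensorAlgebra k V :=
  LinearMap.applyₗ (1 ⊗ₜ[k] 1) ∘ₗ
    (TensorAlgebra.lift k (A := Module.End k (TensorAlgebra k V ⊗[k] TensorAlgebra k V))
      (TensorProduct.curry
          (M.tensorAlgebra.tensorMul (LinearMap.mul' k (TensorAlgebra k V))) ∘ₗ
        ((TensorProduct.mk k (TensorAlgebra k V) (TensorAlgebra k V)).flip 1 +
          TensorProduct.mk k (TensorAlgebra k V) (TensorAlgebra k V) 1) ∘ₗ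
        TensorAlgebra.ι k)).toLinearMap

/-- The two-sided ideals `I` of `T(V)` spanned by homogeneous elements of degrees `≥ 2` which are
Yetter-Drinfeld submodules and coideals: `Δ(I) ⊆ I ⊗ T(V) + T(V) ⊗ I`. -/
structure IsNicholsIdeal (M : YDData k Γ V) (I : Ideal (TensorAlgebra k V)) : Prop where
  isTwoSided : I.IsTwoSided
  graded : ∀ x ∈ I, x ∈ Submodule.span k
    {y | y ∈ I ∧ ∃ n : ℕ, 2 ≤ n ∧ y ∈ LinearMap.range (TensorAlgebra.ι k (M := V)) ^ n}
  act_mem : ∀ g : Γ, ∀ x ∈ I, M.tensorAlgebra.act g x ∈ I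
  coact_mem : ∀ x ∈ I, M.tensorAlgebra.coact x ∈
    LinearMap.range ((I.restrictScalars k).subtype.lTensor (MonoidAlgebra k Γ))
  comul_mem : ∀ x ∈ I, M.tensorComul x ∈
    LinearMap.range ((I.restrictScalars k).subtype.rTensor (TensorAlgebra k V)) ⊔
      LinearMap.range ((I.restrictScalars k).subtype.lTensor (TensorAlgebra k V))

/-- The defining ideal of the Nichols algebra: the sum of all the ideals as in
`IsNicholsIdeal`. -/
def nicholsIdeal (M : YDData k Γ V) : Ideal (TensorAlgebra k V) :=
  sSup {I | M.IsNicholsIdeal I}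

theorem nicholsIdeal_induction (M : YDData k Γ V) {P : Submodule k (TensorAlgebra k V)}
    (h : ∀ I, M.IsNicholsIdeal I → ∀ x ∈ I, x ∈ P) {x : TensorAlgebra k V}
    (hx : x ∈ M.nicholsIdeal) : x ∈ P := by
  unfold nicholsIdeal at hx
  rw [sSup_eq_iSup'] at hx
  induction hx using Submodule.iSup_induction' with
  | mem I x hx => exact h I.1 I.2 x hx
  | zero => exact P.zero_mem
  | add x y _ _ hx hy => exact P.add_mem hx hy

theorem le_nicholsIdeal (M : YDData k Γ V) {I : Ideal (TensorAlgebra k V)}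
    (h : M.IsNicholsIdeal I) : I ≤ M.nicholsIdeal := le_sSup h

instance (M : YDData k Γ V) : M.nicholsIdeal.IsTwoSided where
  mul_mem_of_left b hx :=
    M.nicholsIdeal_induction
      (P := (M.nicholsIdeal.restrictScalars k).comap (LinearMap.mulRight k b))
      (fun _ hI _ hx => M.le_nicholsIdeal hI (hI.isTwoSided.mul_mem_of_left b hx)) hx

/-- The Nichols algebra `B(V)`, as a quotient algebra of the tensor algebra. -/
abbrev Nichols (M : YDData k Γ V) : Type _ := TensorAlgebra k V ⧸ M.nicholsIdeal

/-- The canonical projection `T(V) → B(V)`. -/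
def toNichols (M : YDData k Γ V) : TensorAlgebra k V →ₗ[k] M.Nichols :=
  (Ideal.Quotient.mkₐ k M.nicholsIdeal).toLinearMap

/-- The linear map `B(V) → W` induced by a linear map `T(V) → W` that vanishes on the defining
ideal. -/
def nicholsDesc (M : YDData k Γ V) {W : Type*} [AddCommGroup W] [Module k W]
    (f : TensorAlgebra k V →ₗ[k] W)
    (hf : ∀ I, M.IsNicholsIdeal I → ∀ x ∈ I, f x = 0) : M.Nichols →ₗ[k] W :=
  (M.nicholsIdeal.restrictScalars k).liftQ f
    (fun _ hx => M.nicholsIdeal_induction (P := LinearMap.ker f) hf hx) ∘ₗ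
  (Submodule.Quotient.restrictScalarsEquiv k M.nicholsIdeal).symm.toLinearMap

theorem nicholsDesc_toNichols (M : YDData k Γ V) {W : Type*} [AddCommGroup W] [Module k W]
    (f : TensorAlgebra k V →ₗ[k] W) (hf : ∀ I, M.IsNicholsIdeal I → ∀ x ∈ I, f x = 0)
    (x : TensorAlgebra k V) : M.nicholsDesc f hf (M.toNichols x) = f x := rfl

theorem toNichols_eq_zero (M : YDData k Γ V) {I : Ideal (TensorAlgebra k V)}
    (hI : M.IsNicholsIdeal I) {x : TensorAlgebra k V} (hx : x ∈ I) : M.toNichols x = 0 :=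
  Ideal.Quotient.eq_zero_iff_mem.2 (M.le_nicholsIdeal hI hx)

theorem toNichols_comp_subtype (M : YDData k Γ V) {I : Ideal (TensorAlgebra k V)}
    (hI : M.IsNicholsIdeal I) : M.toNichols ∘ₗ (I.restrictScalars k).subtype = 0 :=
  LinearMap.ext fun x => M.toNichols_eq_zero hI x.2

theorem counit_eq_zero (M : YDData k Γ V) {I : Ideal (TensorAlgebra k V)}
    (hI : M.IsNicholsIdeal I) {x : TensorAlgebra k V} (hx : x ∈ I) :
    TensorAlgebra.algebraMapInv (R := k) x = 0 := by
  have h := hI.graded x hx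
  have hle : Submodule.span k
      {y | y ∈ I ∧ ∃ n : ℕ, 2 ≤ n ∧ y ∈ LinearMap.range (TensorAlgebra.ι k (M := V)) ^ n} ≤
      LinearMap.ker (TensorAlgebra.algebraMapInv (R := k) (M := V)).toLinearMap := by
    rw [Submodule.span_le]
    rintro y ⟨-, n, hn, hy⟩
    have h1 : (LinearMap.range (TensorAlgebra.ι k (M := V))).map
        (TensorAlgebra.algebraMapInv (R := k) (M := V)).toLinearMap = ⊥ := by
      rw [eq_bot_iff, Submodule.map_le_iff_le_comap]
      rintro _ ⟨v, rfl⟩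
      simp [TensorAlgebra.algebraMapInv]
    have h2 := Submodule.mem_map_of_mem
      (f := (TensorAlgebra.algebraMapInv (R := k) (M := V)).toLinearMap) hy
    rw [Submodule.map_pow, h1, Submodule.bot_pow (by omega)] at h2
    exact h2
  exact hle h

/-- The Nichols algebra `B(V)` as a Hopf algebra in Yetter-Drinfeld modules: all the structure
maps are induced by those of `T(V)`. -/
def nichols (M : YDData k Γ V) : HopfData k Γ M.Nichols where
  act g := M.nicholsDesc (M.toNichols ∘ₗ M.tensorAlgebra.act g)
    (fun _ hI x hx => M.toNichols_eq_zero hI (hI.act_mem g x hx))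
  coact := M.nicholsDesc (M.toNichols.lTensor (MonoidAlgebra k Γ) ∘ₗ M.tensorAlgebra.coact)
    (fun _ hI x hx => by
      obtain ⟨z, hz⟩ := hI.coact_mem x hx
      rw [LinearMap.comp_apply, ← hz, ← LinearMap.comp_apply, ← LinearMap.lTensor_comp,
        M.toNichols_comp_subtype hI, LinearMap.lTensor_zero, LinearMap.zero_apply])
  mul := LinearMap.mul' k M.Nichols
  one := 1
  comul := M.nicholsDesc (TensorProduct.map M.toNichols M.toNichols ∘ₗ M.tensorComul)
    (fun _ hI x hx => by
      obtain ⟨_, ⟨y, rfl⟩, _, ⟨z, rfl⟩, h⟩ := Submodule.mem_sup.1 (hI.comul_mem x hx)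
      rw [LinearMap.comp_apply, ← h, map_add, ← LinearMap.comp_apply, ← LinearMap.comp_apply,
        LinearMap.rTensor, LinearMap.lTensor, ← TensorProduct.map_comp,
        ← TensorProduct.map_comp, M.toNichols_comp_subtype hI]
      simp)
  counit := M.nicholsDesc (TensorAlgebra.algebraMapInv (R := k)).toLinearMap
    (fun _ hI _ hx => M.counit_eq_zero hI hx)

end YDData

end Nichols

/-! ### The braided vector spaces with blocks and points -/

section BlocksPoints

variable {k : Type*} [Field k] {p t θ : ℕ} [CharP k p]

/-- The vector space with basis `x_i`, `i ∈ Fin θ`, and `y_j`, `j ∈ Fin t`: the basis vector `x_i`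
is indexed by `Sum.inl i` and `y_j` by `Sum.inr j`. The blocks are the indices `i` with `i < t`, the
points are the indices `i` with `t ≤ i`. -/
abbrev BPSpace (k : Type*) [Field k] (t θ : ℕ) : Type _ := (Fin θ ⊕ Fin t) →₀ k

/-- The basis vector `x_i`. -/
def vx (i : Fin θ) : BPSpace k t θ := Finsupp.single (Sum.inl i) 1

/-- The basis vector `y_j`. -/
def vy (j : Fin t) : BPSpace k t θ := Finsupp.single (Sum.inr j) 1

/-- The coefficient `s_ij` such that `c (x_i ⊗ y_j) = q_ij (y_j + s_ij x_j) ⊗ x_i`: it is `a_ij` if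
`i` is a point, `1` if `i = j`, and `0` if `i ≠ j` is a block. -/
def shear (k : Type*) [Field k] {p t θ : ℕ} [CharP k p] (h : t < θ)
    (a : {i : Fin θ // t ≤ i.val} → Fin t → ZMod p) (i : Fin θ) (j : Fin t) : k :=
  if hi : t ≤ i.val then ZMod.castHom (dvd_refl p) k (a ⟨i, hi⟩ j)
  else if i = Fin.castLE h.le j then 1 else 0

/-- The values of the braiding of `V(q, a)` on the basis. -/
def bpBraidingBasis (h : t < θ) (q : Fin θ → Fin θ → kˣ)
    (a : {i : Fin θ // t ≤ i.val} → Fin t → ZMod p) :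
    Fin θ ⊕ Fin t → Fin θ ⊕ Fin t → BPSpace k t θ ⊗[k] BPSpace k t θ
  | Sum.inl i, Sum.inl j => (q i j : k) • (vx j ⊗ₜ[k] vx i)
  | Sum.inr i, Sum.inl j => (q (Fin.castLE h.le i) j : k) • (vx j ⊗ₜ[k] vy i)
  | Sum.inl i, Sum.inr j => (q i (Fin.castLE h.le j) : k) •
      ((vy j + shear k h a i j • vx (Fin.castLE h.le j)) ⊗ₜ[k] vx i)
  | Sum.inr i, Sum.inr j => (q (Fin.castLE h.le i) (Fin.castLE h.le j) : k) •
      ((vy j + shear k h a (Fin.castLE h.le i) j • vx (Fin.castLE h.le j)) ⊗ₜ[k] vy i)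

/-- The braiding of `V(q, a)`. -/
def bpBraiding (h : t < θ) (q : Fin θ → Fin θ → kˣ)
    (a : {i : Fin θ // t ≤ i.val} → Fin t → ZMod p) :
    BPSpace k t θ ⊗[k] BPSpace k t θ →ₗ[k] BPSpace k t θ ⊗[k] BPSpace k t θ :=
  TensorProduct.lift (Finsupp.linearCombination k fun b =>
    Finsupp.linearCombination k (bpBraidingBasis h q a b))

/-- The group `Γ = (ℤ/f)^θ`, written multiplicatively. -/
abbrev BPGroup (f θ : ℕ) : Type := Fin θ → Multiplicative (ZMod f)

/-- The canonical generator `g_i` of `Γ`. -/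
def gen (f : ℕ) {θ : ℕ} (i : Fin θ) : BPGroup f θ :=
  Pi.mulSingle i (Multiplicative.ofAdd 1)

/-- `M` is the standard realization of `V(q, a)` over `Γ = (ℤ/f)^θ`: the vectors `x_i` and `y_j`
have degrees `g_i` and `g_j`, and the action is
`g_i • x_j = q_ij x_j`, `g_i • y_j = q_ij (y_j + s_ij x_j)` with `s_ij = a_ij` if `i` is a point,
`s_jj = 1` and `s_ij = 0` if `i ≠ j` is a block. -/
structure IsStandardRealization {f : ℕ} (h : t < θ) (q : Fin θ → Fin θ → kˣ)
    (a : {i : Fin θ // t ≤ i.val} → Fin t → ZMod p)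
    (M : YDData k (BPGroup f θ) (BPSpace k t θ)) : Prop where
  isYD : M.IsYD
  act_x : ∀ i j : Fin θ, M.act (gen f i) (vx j) = (q i j : k) • vx j
  act_y : ∀ (i : Fin θ) (j : Fin t), M.act (gen f i) (vy j) =
    (q i (Fin.castLE h.le j) : k) • (vy j + shear k h a i j • vx (Fin.castLE h.le j))
  coact_x : ∀ i : Fin θ, M.coact (vx i) = MonoidAlgebra.single (gen f i) 1 ⊗ₜ[k] vx i
  coact_y : ∀ j : Fin t, M.coact (vy j) =
    MonoidAlgebra.single (gen f (Fin.castLE h.le j)) 1 ⊗ₜ[k] vy j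

end BlocksPoints

end BraidedHopf

end

/-! The realization is explicit. The element `g` acts on `x_j` by a character `χ_j`, and sends `y_j`
to `χ_j(g) (y_j + s_j(g) x_j)` with `s_j` additive in `g`. Both extend from the generators because
`f` is divisible by `p` and by the orders of the `q_ij`. Since `x_j` and `y_j` have the same degree
`g_j`, twisting the action by `σ` multiplies `χ_j` by `σ(g, g_j) σ(g_j, g)⁻¹` and leaves `s_j`
alone. So `V(q', a)` is the twist of `V(q, a)` as soon as `σ(g_i, g_j) σ(g_j, g_i)⁻¹ q_ij = q'_ij`.
The triangular form `σ` has this property because `q_ij q_ji = q'_ij q'_ji` and `q_ii = q'_ii`.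

The rest holds for every Yetter-Drinfeld module `M` over an abelian group and its twist `M'`. The
linear map `twistMap`, which multiplies `v₁ ⋯ vₙ` by the product of the `σ(deg vᵢ, deg vⱼ)` over `i
< j`, is an isomorphism of Hopf algebras from `T(M')` to `T(M)_σ` (`IsTwist.twistMap_isHopfHom`). It
carries the ideals admitted in the definition of the Nichols algebra of `M'` to those for `M`, and
its inverse carries them back (`IsTwist.map_isNicholsSub`). So the composite `T(M') → T(M)_σ →
B(M)_σ` is a surjective Hopf map whose kernel is the defining ideal of `B(M')`, which gives both the
Hopf property of `B(M)_σ` and the isomorphism (`IsTwist.nichols`).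

That Nichols algebras are Hopf algebras is obtained from `T(M)` by the quotient lemma
`HopfData.IsHopf.of_surjective`. The antipode must be bijective on the quotient, so both it and its
inverse have to preserve the defining ideal; this follows from the braided anti-multiplicativity and
anti-comultiplicativity of the antipode (`IsYD.antipode_mul`, `IsYD.tensorComul_antipode`).

The structure maps are linear maps with simple formulas on homogeneous elements only. Identities are
therefore stated between linear maps and checked on homogeneous elements (`Homog.ext₂`) or, in the
tensor algebra, letter by letter on words (`word_ext`). -/

noncomputable section

namespace BraidedHopf

namespace YDData

variable {k Γ V W U : Type*} [Field k] [CommGroup Γ] [AddCommGroup V] [Module k V]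
  [AddCommGroup W] [Module k W] [AddCommGroup U] [Module k U]

/-! ### Homogeneous elements -/

/-- `v` is homogeneous of degree `g`. -/
def Deg (M : YDData k Γ V) (g : Γ) (v : V) : Prop :=
  M.coact v = MonoidAlgebra.single g 1 ⊗ₜ v

/-- `V` is spanned by homogeneous elements. -/
def Homog (M : YDData k Γ V) : Prop :=
  Submodule.span k {v | ∃ g, M.Deg g v} = ⊤

theorem Deg.smul {M : YDData k Γ V} {g : Γ} {v : V} (h : M.Deg g v) (c : k) :
    M.Deg g (c • v) := by
  unfold Deg at *
  rw [map_smul, h, TensorProduct.tmul_smul]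

theorem Deg.neg {M : YDData k Γ V} {g : Γ} {v : V} (h : M.Deg g v) : M.Deg g (-v) := by
  unfold Deg at *
  rw [map_neg, h, TensorProduct.tmul_neg]

theorem Homog.ext {M : YDData k Γ V} (hM : M.Homog) {f f' : V →ₗ[k] W}
    (h : ∀ g v, M.Deg g v → f v = f' v) : f = f' := by
  refine LinearMap.ext_on hM ?_
  rintro v ⟨g, hv⟩
  exact h g v hv

theorem Homog.induction {M : YDData k Γ V} (hM : M.Homog) {P : V → Prop}
    (h : ∀ g v, M.Deg g v → P v) (h0 : P 0) (hadd : ∀ v w, P v → P w → P (v + w)) (v : V) :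
    P v := by
  have hv : v ∈ Submodule.span k {v | ∃ g, M.Deg g v} := hM ▸ Submodule.mem_top
  -- Homogeneous elements of a fixed degree are closed under scalars, so additive closure suffices
  -- and no scalar case appears in the induction.
  rw [← Submodule.mem_toAddSubmonoid, Submodule.span_eq_closure] at hv
  induction hv using AddSubmonoid.closure_induction with
  | mem x hx =>
    obtain ⟨c, -, v, ⟨g, hv⟩, rfl⟩ := hx
    exact h g _ (hv.smul c)
  | zero => exact h0
  | add x y _ _ hx hy => exact hadd x y hx hy

theorem Homog.ext₂ {M : YDData k Γ V} (hM : M.Homog) {N : YDData k Γ W} (hN : N.Homog)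
    {f f' : V ⊗[k] W →ₗ[k] U}
    (h : ∀ g v, M.Deg g v → ∀ g' w, N.Deg g' w → f (v ⊗ₜ w) = f' (v ⊗ₜ w)) : f = f' := by
  refine TensorProduct.ext (hM.ext fun g v hv => hN.ext fun g' w hw => ?_)
  exact h g v hv g' w hw

/-! ### Formulas on homogeneous elements -/

theorem braiding_tmul (M : YDData k Γ V) (N : YDData k Γ W) {g : Γ} {v : V} (hv : M.Deg g v)
    (w : W) : M.braiding N (v ⊗ₜ w) = N.act g w ⊗ₜ v := by
  unfold Deg at hv
  simp [braiding, hv, actLin]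

theorem Deg.tmul {M : YDData k Γ V} {N : YDData k Γ W} {g h : Γ} {v : V} {w : W}
    (hv : M.Deg g v) (hw : N.Deg h w) : (M.tensor N).Deg (g * h) (v ⊗ₜ w) := by
  unfold Deg at *
  simp [tensor, hv, hw, MonoidAlgebra.single_mul_single]

theorem tensorMul_tmul (M : YDData k Γ V) (m : V ⊗[k] V →ₗ[k] V) {h : Γ} {b : V}
    (hb : M.Deg h b) (a c d : V) :
    M.tensorMul m ((a ⊗ₜ b) ⊗ₜ (c ⊗ₜ d)) = m (a ⊗ₜ M.act h c) ⊗ₜ m (b ⊗ₜ d) := by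
  simp [tensorMul, M.braiding_tmul M hb]

theorem _root_.BraidedHopf.linExt_single {Γ : Type*} (χ : Γ → kˣ) (g : Γ) :
    linExt χ (MonoidAlgebra.single g 1) = χ g := by
  simp [linExt]

theorem _root_.BraidedHopf.bilinExt_single (σ : Γ →* Γ →* kˣ) (g h : Γ) :
    bilinExt σ (MonoidAlgebra.single g 1 ⊗ₜ MonoidAlgebra.single h 1) = σ g h := by
  simp [bilinExt, linExt]

theorem scale_tmul (M : YDData k Γ V) (σ : Γ →* Γ →* kˣ) {g h : Γ} {v w : V} (hv : M.Deg g v)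
    (hw : M.Deg h w) : M.scale σ (v ⊗ₜ w) = (σ g h : k) • (v ⊗ₜ w) := by
  unfold Deg at *
  simp [scale, hv, hw, bilinExt_single]

theorem _root_.BraidedHopf.HopfData.twist_act (A : HopfData k Γ V) (σ : Γ →* Γ →* kˣ) (g : Γ)
    {h : Γ} {v : V} (hv : A.Deg h v) :
    (A.twist σ).act g v = ((σ g h * (σ h g)⁻¹ : kˣ) : k) • A.act g v := by
  unfold Deg at *
  simp [HopfData.twist, hv, linExt_single]

/-! ### Yetter-Drinfeld modules and morphisms in terms of homogeneous elements -/

/-- On an element of degree `g` the two comodule axioms reduce to `Δ(g) = g ⊗ g` and `ε(g) = 1`, so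
only the action remains to be checked. -/
theorem isYD_of_homog {M : YDData k Γ V} (hM : M.Homog) (h1 : M.act 1 = LinearMap.id)
    (hmul : ∀ g h : Γ, M.act (g * h) = M.act g ∘ₗ M.act h)
    (hcompat : ∀ g : Γ, M.coact ∘ₗ M.act g = (M.act g).lTensor (MonoidAlgebra k Γ) ∘ₗ M.coact) :
    M.IsYD where
  act_one := h1
  act_mul := hmul
  coassoc := hM.ext fun g v hv => by unfold Deg at hv; simp [hv]
  counit_coact := hM.ext fun g v hv => by unfold Deg at hv; simp [hv]
  compat := hcompat

theorem IsYD.deg_act {M : YDData k Γ V} (hM : M.IsYD) (g : Γ) {h : Γ} {v : V} (hv : M.Deg h v) :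
    M.Deg h (M.act g v) := by
  have := LinearMap.congr_fun (hM.compat g) v
  unfold Deg at *
  simpa [hv] using this

theorem exists_finsupp_tmul {Γ : Type*} (z : MonoidAlgebra k Γ ⊗[k] V) :
    ∃ c : Γ →₀ V, z = c.sum fun g v => MonoidAlgebra.single g 1 ⊗ₜ v := by
  classical
  induction z with
  | zero => exact ⟨0, by simp⟩
  | add x y hx hy =>
    obtain ⟨c, rfl⟩ := hx
    obtain ⟨d, rfl⟩ := hy
    exact ⟨c + d, by rw [Finsupp.sum_add_index'] <;> simp [TensorProduct.tmul_add]⟩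
  | tmul a v =>
    induction a using MonoidAlgebra.induction_linear with
    | zero => exact ⟨0, by simp⟩
    | add x y hx hy =>
      obtain ⟨c, hc⟩ := hx
      obtain ⟨d, hd⟩ := hy
      refine ⟨c + d, ?_⟩
      rw [TensorProduct.add_tmul, hc, hd, Finsupp.sum_add_index'] <;>
        simp [TensorProduct.tmul_add]
    | single g r =>
      refine ⟨Finsupp.single g (r • v), ?_⟩
      rw [Finsupp.sum_single_index (by simp), ← TensorProduct.smul_tmul]
      simp

/-- The coordinate functional of `kΓ` at `h`. -/
def coord (k : Type*) {Γ : Type*} [Field k] (h : Γ) : MonoidAlgebra k Γ →ₗ[k] k :=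
  Finsupp.lapply h ∘ₗ (MonoidAlgebra.coeffLinearEquiv k).toLinearMap

theorem coord_single_self {Γ : Type*} (h : Γ) : coord k h (MonoidAlgebra.single h 1) = 1 := by
  simp [coord]

theorem coord_single_ne {Γ : Type*} {g h : Γ} (hg : g ≠ h) :
    coord k h (MonoidAlgebra.single g 1) = 0 := by
  simp [coord, hg]

/-- Write the coaction of `x` as a sum of `g ⊗ c_g` with `c_g ∈ S`. The counit axiom gives `x = ∑
c_g`, and coassociativity forces each `c_g` to be homogeneous of degree `g`. This turns the
subcomodule condition on an ideal into generation by homogeneous elements; with `S = ⊤` it gives the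
grading of any Yetter-Drinfeld module. -/
theorem IsYD.mem_span_deg {M : YDData k Γ V} (hM : M.IsYD) {S : Submodule k V} {x : V}
    (hx : M.coact x ∈ LinearMap.range (S.subtype.lTensor (MonoidAlgebra k Γ))) :
    x ∈ Submodule.span k {v | v ∈ S ∧ ∃ g, M.Deg g v} := by
  obtain ⟨z, hz⟩ := hx
  obtain ⟨c, rfl⟩ := exists_finsupp_tmul z
  have hx : M.coact x = c.sum fun g v => MonoidAlgebra.single g 1 ⊗ₜ (v : V) := by
    rw [← hz, map_finsuppSum]; simp
  have hsum : x = c.sum fun g v => (v : V) := by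
    have := LinearMap.congr_fun hM.counit_coact x
    simp only [LinearMap.comp_apply, hx, map_finsuppSum] at this
    simpa using this.symm
  have hdeg : ∀ h, M.Deg h (c h : V) := by
    intro h
    have := LinearMap.congr_fun hM.coassoc x
    simp only [LinearMap.comp_apply, hx, map_finsuppSum] at this
    -- Coassociativity reads `∑ g ⊗ g ⊗ c_g = ∑ g ⊗ coact c_g`; the coordinate at `h` in the first
    -- factor isolates `coact (c h)`.
    have := congrArg (TensorProduct.lid k _ ∘ (coord k h).rTensor _) this
    simp only [Function.comp_apply, map_finsuppSum] at this
    rw [Finsupp.sum_eq_single h, Finsupp.sum_eq_single h] at this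
    · simpa [coord_single_self, Deg] using this.symm
    · intro b _ hb; simp [coord_single_ne hb]
    · intro; simp
    · intro b _ hb; simp [coord_single_ne hb]
    · intro; simp
  rw [hsum]
  exact Submodule.sum_mem _ fun g _ => Submodule.subset_span ⟨(c g).2, g, hdeg g⟩

theorem IsYD.homog {M : YDData k Γ V} (hM : M.IsYD) : M.Homog := by
  unfold Homog
  rw [eq_top_iff]
  rintro x -
  have := hM.mem_span_deg (S := ⊤) (x := x) (by
    rw [LinearMap.range_eq_top.2 (LinearMap.lTensor_surjective _ ?_)]
    · trivial
    · rintro x; exact ⟨⟨x, trivial⟩, rfl⟩)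
  simpa using this

theorem IsHom.deg {M : YDData k Γ V} {N : YDData k Γ W} {f : V →ₗ[k] W} (hf : M.IsHom N f)
    {g : Γ} {v : V} (hv : M.Deg g v) : N.Deg g (f v) := by
  have := LinearMap.congr_fun hf.2 v
  unfold Deg at *
  simpa [hv] using this

theorem IsHom.act {M : YDData k Γ V} {N : YDData k Γ W} {f : V →ₗ[k] W} (hf : M.IsHom N f)
    (g : Γ) (v : V) : f (M.act g v) = N.act g (f v) :=
  LinearMap.congr_fun (hf.1 g) v

theorem Homog.isHom {M : YDData k Γ V} (hM : M.Homog) {N : YDData k Γ W} {f : V →ₗ[k] W}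
    (hact : ∀ g h v, M.Deg h v → f (M.act g v) = N.act g (f v))
    (hdeg : ∀ g v, M.Deg g v → N.Deg g (f v)) : M.IsHom N f := by
  refine ⟨fun g => hM.ext fun h v hv => hact g h v hv, hM.ext fun g v hv => ?_⟩
  have := hdeg g v hv
  unfold Deg at this hv
  simp [this, hv]

theorem unit_deg_one (c : k) : (unit k Γ).Deg 1 c := by
  unfold Deg
  simp [unit, MonoidAlgebra.one_def]

theorem unit_homog : (unit k Γ).Homog := by
  unfold Homog
  rw [eq_top_iff]
  rintro x -
  exact Submodule.subset_span ⟨1, unit_deg_one x⟩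

theorem IsHom.tensor {M : YDData k Γ V} {N : YDData k Γ W} {V' W' : Type*} [AddCommGroup V']
    [Module k V'] [AddCommGroup W'] [Module k W'] {M' : YDData k Γ V'} {N' : YDData k Γ W'}
    (hM : M.Homog) (hN : N.Homog) {f : V →ₗ[k] V'} {g : W →ₗ[k] W'} (hf : M.IsHom M' f)
    (hg : N.IsHom N' g) : (M.tensor N).IsHom (M'.tensor N') (TensorProduct.map f g) := by
  constructor
  · intro a
    refine TensorProduct.ext' fun v w => ?_
    simp [YDData.tensor, hf.act, hg.act]
  · refine hM.ext₂ hN fun a v hv b w hw => ?_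
    have h1 := (hf.deg hv).tmul (hg.deg hw)
    have h2 := hv.tmul hw
    unfold Deg at h1 h2
    simp [h1, h2]

end YDData

namespace HopfData

variable {k Γ R S : Type*} [Field k] [CommGroup Γ] [AddCommGroup R] [Module k R]
  [AddCommGroup S] [Module k S]

/-! ### Morphisms and quotients of Hopf algebras -/

/-- `f` is a morphism of Hopf algebras in the category of Yetter-Drinfeld modules. -/
structure IsHopfHom (A : HopfData k Γ R) (B : HopfData k Γ S) (f : R →ₗ[k] S) : Prop where
  isHom : A.toYDData.IsHom B.toYDData f
  map_mul : ∀ x y, f (A.mul (x ⊗ₜ y)) = B.mul (f x ⊗ₜ f y)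
  map_one : f A.one = B.one
  map_comul : ∀ x, B.comul (f x) = TensorProduct.map f f (A.comul x)
  map_counit : ∀ x, B.counit (f x) = A.counit x

/-- `s` is a bijective antipode of `A`. -/
structure IsAntipode (A : HopfData k Γ R) (s : R →ₗ[k] R) : Prop where
  bijective : Function.Bijective s
  isHom : A.toYDData.IsHom A.toYDData s
  mul_rTensor : ∀ x, A.mul (s.rTensor R (A.comul x)) = A.counit x • A.one
  mul_lTensor : ∀ x, A.mul (s.lTensor R (A.comul x)) = A.counit x • A.one

theorem IsHopfHom.comp {Q : Type*} [AddCommGroup Q] [Module k Q] {A : HopfData k Γ R}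
    {B : HopfData k Γ S} {C : HopfData k Γ Q} {f : R →ₗ[k] S} {g : S →ₗ[k] Q}
    (hg : B.IsHopfHom C g) (hf : A.IsHopfHom B f) : A.IsHopfHom C (g ∘ₗ f) where
  isHom := by
    refine ⟨fun a => ?_, ?_⟩
    · rw [LinearMap.comp_assoc, hf.isHom.1, ← LinearMap.comp_assoc, hg.isHom.1,
        LinearMap.comp_assoc]
    · rw [← LinearMap.comp_assoc, hg.isHom.2, LinearMap.comp_assoc, hf.isHom.2,
        LinearMap.lTensor_comp, LinearMap.comp_assoc]
  map_mul x y := by simp [hf.map_mul, hg.map_mul]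
  map_one := by simp [hf.map_one, hg.map_one]
  map_comul x := by simp [hf.map_comul, hg.map_comul, TensorProduct.map_comp]
  map_counit x := by simp [hf.map_counit, hg.map_counit]

variable {A : HopfData k Γ R} {B : HopfData k Γ S} {f : R →ₗ[k] S}

theorem IsHopfHom.map_tensorMul (hf : A.IsHopfHom B f) (hA : A.Homog) (z w : R ⊗[k] R) :
    TensorProduct.map f f (A.tensorMul A.mul (z ⊗ₜ w)) =
      B.tensorMul B.mul (TensorProduct.map f f z ⊗ₜ TensorProduct.map f f w) := by
  induction w with
  | zero => simp
  | add x y hx hy => simp only [TensorProduct.tmul_add, map_add, hx, hy]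
  | tmul c d =>
    induction z with
    | zero => simp
    | add x y hx hy => simp only [TensorProduct.add_tmul, map_add, hx, hy]
    | tmul a b =>
      -- Of the four factors only `b` is moved across the braiding, so only `b` needs a degree.
      induction b using hA.induction with
      | h0 => simp
      | hadd x y hx hy =>
        simp only [TensorProduct.tmul_add, TensorProduct.add_tmul, map_add, hx, hy]
      | h g b hb =>
        simp [YDData.tensorMul_tmul _ _ hb, YDData.tensorMul_tmul _ _ (hf.isHom.deg hb),
          hf.map_mul, hf.isHom.act]

/-- A quotient of a Hopf algebra by an ideal that is compatible with all structure maps and the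
antipode is a Hopf algebra. -/
theorem IsHopf.of_surjective (hA : A.IsHopf) (hf : A.IsHopfHom B f)
    (hs : Function.Surjective f) {s : R →ₗ[k] R} (hS : A.IsAntipode s)
    (hker : ∀ x, f (s x) = 0 ↔ f x = 0) : B.IsHopf := by
  have hAh := hA.isYD.homog
  have hactf : ∀ g, B.act g ∘ₗ f = f ∘ₗ A.act g := fun g => (hf.isHom.1 g).symm
  have hcf : B.comul ∘ₗ f = TensorProduct.map f f ∘ₗ A.comul :=
    LinearMap.ext fun x => hf.map_comul x
  have hεf : B.counit ∘ₗ f = A.counit := LinearMap.ext fun x => hf.map_counit x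
  have hmulf : B.mul ∘ₗ TensorProduct.map f f = f ∘ₗ A.mul :=
    TensorProduct.ext' fun x y => (hf.map_mul x y).symm
  constructor
  case isYD =>
    -- Each axiom for `B` is an equality of linear maps, so it may be tested after composition with
    -- the surjection `f`, where it becomes the axiom for `A`. The remaining cases follow the same
    -- pattern.
    refine ⟨(LinearMap.cancel_right hs).1 ?_, fun g h => (LinearMap.cancel_right hs).1 ?_,
      (LinearMap.cancel_right hs).1 ?_, (LinearMap.cancel_right hs).1 ?_,
      fun g => (LinearMap.cancel_right hs).1 ?_⟩
    · rw [hactf, hA.isYD.act_one]; rfl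
    · rw [hactf, LinearMap.comp_assoc, hactf, ← LinearMap.comp_assoc, hactf, hA.isYD.act_mul]; rfl
    · refine hAh.ext fun g v hv => ?_
      have := hf.isHom.deg hv
      unfold YDData.Deg at this
      simp [this]
    · refine hAh.ext fun g v hv => ?_
      have := hf.isHom.deg hv
      unfold YDData.Deg at this
      simp [this]
    · refine hAh.ext fun h v hv => ?_
      have h1 := hf.isHom.deg hv
      have h2 := hf.isHom.deg (hA.isYD.deg_act g hv)
      rw [hf.isHom.act] at h2
      unfold YDData.Deg at h1 h2
      simp [h1, h2]
  case mul_assoc =>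
    intro x y z
    obtain ⟨x, rfl⟩ := hs x; obtain ⟨y, rfl⟩ := hs y; obtain ⟨z, rfl⟩ := hs z
    simp only [← hf.map_mul, hA.mul_assoc]
  case one_mul =>
    intro x
    obtain ⟨x, rfl⟩ := hs x
    rw [← hf.map_one, ← hf.map_mul, hA.one_mul]
  case mul_one =>
    intro x
    obtain ⟨x, rfl⟩ := hs x
    rw [← hf.map_one, ← hf.map_mul, hA.mul_one]
  case mul_hom =>
    have ht := hf.isHom.tensor hAh hAh hf.isHom
    have hss := TensorProduct.map_surjective hs hs
    refine ⟨fun g => (LinearMap.cancel_right hss).1 ?_, (LinearMap.cancel_right hss).1 ?_⟩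
    · rw [LinearMap.comp_assoc, ← ht.1, ← LinearMap.comp_assoc, hmulf, LinearMap.comp_assoc,
        hA.mul_hom.1, LinearMap.comp_assoc, hmulf, ← LinearMap.comp_assoc, ← LinearMap.comp_assoc,
        hactf]
    · rw [LinearMap.comp_assoc, hmulf, ← LinearMap.comp_assoc, hf.isHom.2, LinearMap.comp_assoc,
        hA.mul_hom.2, LinearMap.comp_assoc, ht.2, ← LinearMap.comp_assoc, ← LinearMap.comp_assoc,
        ← LinearMap.lTensor_comp, ← LinearMap.lTensor_comp, hmulf]
  case one_hom =>
    refine YDData.unit_homog.isHom (fun g h v _ => ?_) (fun g v hv => ?_)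
    · have h1 := hf.isHom.act g A.one
      have h2 := hA.one_hom.act g 1
      simp only [LinearMap.toSpanSingleton_apply, one_smul, YDData.unit, LinearMap.id_apply] at h2
      simp [YDData.unit, ← hf.map_one, ← h1, ← h2]
    · have h1 := hf.isHom.deg (hA.one_hom.deg hv)
      simpa [hf.map_one] using h1
  case coassoc =>
    refine (LinearMap.cancel_right hs).1 ?_
    rw [LinearMap.comp_assoc, LinearMap.comp_assoc, hcf, LinearMap.comp_assoc, hcf,
      ← LinearMap.comp_assoc _ _ (LinearMap.rTensor S B.comul),
      ← LinearMap.comp_assoc _ _ (LinearMap.lTensor S B.comul), LinearMap.rTensor_comp_map,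
      LinearMap.lTensor_comp_map, hcf, ← LinearMap.map_comp_rTensor, ← LinearMap.map_comp_lTensor,
      LinearMap.comp_assoc, LinearMap.comp_assoc, ← hA.coassoc, ← LinearMap.comp_assoc,
      ← LinearMap.comp_assoc _ _ (TensorProduct.map f (TensorProduct.map f f))]
    congr 1
    exact TensorProduct.ext_threefold fun x y z => by simp
  case counit_left =>
    refine (LinearMap.cancel_right hs).1 ?_
    rw [LinearMap.comp_assoc, LinearMap.comp_assoc, hcf,
      ← LinearMap.comp_assoc _ _ (LinearMap.rTensor S B.counit), LinearMap.rTensor_comp_map, hεf]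
    have : f = f ∘ₗ LinearMap.id := rfl
    rw [LinearMap.id_comp]
    conv_rhs => rw [this, ← hA.counit_left]
    rw [← LinearMap.comp_assoc, ← LinearMap.comp_assoc, ← LinearMap.comp_assoc]
    congr 1
    exact TensorProduct.ext' fun x y => by simp
  case counit_right =>
    refine (LinearMap.cancel_right hs).1 ?_
    rw [LinearMap.comp_assoc, LinearMap.comp_assoc, hcf,
      ← LinearMap.comp_assoc _ _ (LinearMap.lTensor S B.counit), LinearMap.lTensor_comp_map, hεf]
    have : f = f ∘ₗ LinearMap.id := rfl
    rw [LinearMap.id_comp]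
    conv_rhs => rw [this, ← hA.counit_right]
    rw [← LinearMap.comp_assoc, ← LinearMap.comp_assoc, ← LinearMap.comp_assoc]
    congr 1
    exact TensorProduct.ext' fun x y => by simp
  case comul_hom =>
    have ht := hf.isHom.tensor hAh hAh hf.isHom
    refine ⟨fun g => (LinearMap.cancel_right hs).1 ?_, (LinearMap.cancel_right hs).1 ?_⟩
    · rw [LinearMap.comp_assoc, hactf, ← LinearMap.comp_assoc, hcf, LinearMap.comp_assoc,
        hA.comul_hom.1, ← LinearMap.comp_assoc, ht.1, LinearMap.comp_assoc, LinearMap.comp_assoc,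
        hcf]
    · rw [LinearMap.comp_assoc, hcf, ← LinearMap.comp_assoc, ht.2, LinearMap.comp_assoc,
        hA.comul_hom.2, LinearMap.comp_assoc, hf.isHom.2, ← LinearMap.comp_assoc,
        ← LinearMap.comp_assoc, ← LinearMap.lTensor_comp, ← LinearMap.lTensor_comp, hcf]
  case counit_hom =>
    refine ⟨fun g => (LinearMap.cancel_right hs).1 ?_, (LinearMap.cancel_right hs).1 ?_⟩
    · rw [LinearMap.comp_assoc, hactf, ← LinearMap.comp_assoc, hεf, hA.counit_hom.1,
        LinearMap.comp_assoc, hεf]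
    · rw [LinearMap.comp_assoc, hεf, hA.counit_hom.2, LinearMap.comp_assoc, hf.isHom.2,
        ← LinearMap.comp_assoc, ← LinearMap.lTensor_comp, hεf]
  case comul_mul =>
    intro x y
    obtain ⟨x, rfl⟩ := hs x; obtain ⟨y, rfl⟩ := hs y
    rw [← hf.map_mul, hf.map_comul, hA.comul_mul, hf.map_tensorMul hAh, hf.map_comul, hf.map_comul]
  case comul_one => rw [← hf.map_one, hf.map_comul, hA.comul_one]; rfl
  case counit_mul =>
    intro x y
    obtain ⟨x, rfl⟩ := hs x; obtain ⟨y, rfl⟩ := hs y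
    rw [← hf.map_mul, hf.map_counit, hf.map_counit, hf.map_counit, hA.counit_mul]
  case counit_one => rw [← hf.map_one, hf.map_counit, hA.counit_one]
  case antipode =>
    -- The two directions of `hker` are both used: one makes the induced antipode well defined, the
    -- other makes it injective.
    let s' : S →ₗ[k] S := (LinearMap.ker f).liftQ (f ∘ₗ s) (fun x hx => (hker x).2 hx) ∘ₗ
      (f.quotKerEquivOfSurjective hs).symm.toLinearMap
    have hs' : s' ∘ₗ f = f ∘ₗ s := LinearMap.ext fun x => by
      have : (f.quotKerEquivOfSurjective hs).symm (f x) = (LinearMap.ker f).mkQ x := by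
        rw [LinearEquiv.symm_apply_eq]; rfl
      simp only [s', LinearMap.comp_apply, LinearEquiv.coe_coe]
      rw [this]; rfl
    have hs'x : ∀ x, s' (f x) = f (s x) := LinearMap.congr_fun hs'
    refine ⟨s', ⟨?_, fun y => ?_⟩, ⟨fun g => (LinearMap.cancel_right hs).1 ?_,
      (LinearMap.cancel_right hs).1 ?_⟩, fun x => ?_, fun x => ?_⟩
    · rw [← LinearMap.ker_eq_bot, LinearMap.ker_eq_bot']
      intro y hy
      obtain ⟨x, rfl⟩ := hs y
      exact (hker x).1 (hs'x x ▸ hy)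
    · obtain ⟨x, rfl⟩ := hs y
      obtain ⟨x, rfl⟩ := hS.bijective.2 x
      exact ⟨f x, hs'x x⟩
    · rw [LinearMap.comp_assoc, hactf, ← LinearMap.comp_assoc, hs', LinearMap.comp_assoc,
        hS.isHom.1, LinearMap.comp_assoc, hs', ← LinearMap.comp_assoc, ← LinearMap.comp_assoc,
        hactf]
    · rw [LinearMap.comp_assoc, hs', ← LinearMap.comp_assoc, hf.isHom.2, LinearMap.comp_assoc,
        hS.isHom.2, LinearMap.comp_assoc, hf.isHom.2, ← LinearMap.comp_assoc,
        ← LinearMap.comp_assoc, ← LinearMap.lTensor_comp, ← LinearMap.lTensor_comp, hs']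
    · obtain ⟨x, rfl⟩ := hs x
      rw [hf.map_comul, hf.map_counit, ← hf.map_one, ← map_smul, ← hS.mul_rTensor,
        ← LinearMap.comp_apply (LinearMap.rTensor S s'), LinearMap.rTensor_comp_map, hs',
        ← LinearMap.map_comp_rTensor, LinearMap.comp_apply]
      exact LinearMap.congr_fun hmulf _
    · obtain ⟨x, rfl⟩ := hs x
      rw [hf.map_comul, hf.map_counit, ← hf.map_one, ← map_smul, ← hS.mul_lTensor,
        ← LinearMap.comp_apply (LinearMap.lTensor S s'), LinearMap.lTensor_comp_map, hs',
        ← LinearMap.map_comp_lTensor, LinearMap.comp_apply]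
      exact LinearMap.congr_fun hmulf _

/-- Two quotients of `A` by the same ideal are isomorphic. -/
theorem Isomorphic.of_ker_eq {Q : Type*} [AddCommGroup Q] [Module k Q] {C : HopfData k Γ Q}
    {g : R →ₗ[k] Q} (hf : A.IsHopfHom B f) (hg : A.IsHopfHom C g) (hfs : Function.Surjective f)
    (hgs : Function.Surjective g) (hker : LinearMap.ker f = LinearMap.ker g) :
    B.Isomorphic C := by
  let e : S ≃ₗ[k] Q := (f.quotKerEquivOfSurjective hfs).symm ≪≫ₗ
    Submodule.quotEquivOfEq _ _ hker ≪≫ₗ g.quotKerEquivOfSurjective hgs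
  have he : ∀ x, e (f x) = g x := fun x => by
    have : (f.quotKerEquivOfSurjective hfs).symm (f x) = (LinearMap.ker f).mkQ x := by
      rw [LinearEquiv.symm_apply_eq]; rfl
    simp only [e, LinearEquiv.trans_apply]
    rw [this]; rfl
  have he' : e.toLinearMap ∘ₗ f = g := LinearMap.ext he
  refine ⟨e, ⟨fun a => (LinearMap.cancel_right hfs).1 ?_,
    (LinearMap.cancel_right hfs).1 ?_⟩, fun x y => ?_, ?_, fun x => ?_, fun x => ?_⟩
  · rw [LinearMap.comp_assoc, ← hf.isHom.1, ← LinearMap.comp_assoc, he', hg.isHom.1,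
      LinearMap.comp_assoc, he']
  · rw [LinearMap.comp_assoc, he', hg.isHom.2, LinearMap.comp_assoc, hf.isHom.2,
      ← LinearMap.comp_assoc, ← LinearMap.lTensor_comp, he']
  · obtain ⟨x, rfl⟩ := hfs x; obtain ⟨y, rfl⟩ := hfs y
    rw [← hf.map_mul, he, he, he, hg.map_mul]
  · rw [← hf.map_one, he, hg.map_one]
  · obtain ⟨x, rfl⟩ := hfs x
    rw [he, hg.map_comul, hf.map_comul, ← he', TensorProduct.map_comp]; rfl
  · obtain ⟨x, rfl⟩ := hfs x
    rw [he, hg.map_counit, hf.map_counit]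

theorem _root_.BraidedHopf.YDData.IsHom.map_scale {M : YDData k Γ R} {N : YDData k Γ S}
    (hM : M.Homog) (hf : M.IsHom N f) (σ : Γ →* Γ →* kˣ) :
    TensorProduct.map f f ∘ₗ M.scale σ = N.scale σ ∘ₗ TensorProduct.map f f :=
  hM.ext₂ hM fun g v hv h w hw => by
    simp [M.scale_tmul σ hv hw, N.scale_tmul σ (hf.deg hv) (hf.deg hw)]

/-- The twist only inserts scalars that depend on degrees, and `f` preserves degrees. -/
theorem IsHopfHom.twist (hA : A.Homog) (hf : A.IsHopfHom B f) (σ : Γ →* Γ →* kˣ) :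
    (A.twist σ).IsHopfHom (B.twist σ) f where
  isHom := by
    refine YDData.Homog.isHom (M := (A.twist σ).toYDData) hA (fun g h v hv => ?_)
      (fun g v hv => hf.isHom.deg hv)
    rw [A.twist_act σ g hv, B.twist_act σ g (hf.isHom.deg hv), map_smul, hf.isHom.act]
  map_mul x y := by
    have h1 := LinearMap.congr_fun (hf.isHom.map_scale hA σ) (x ⊗ₜ y)
    have h2 : B.mul ∘ₗ TensorProduct.map f f = f ∘ₗ A.mul :=
      TensorProduct.ext' fun x y => (hf.map_mul x y).symm
    simp only [LinearMap.comp_apply, TensorProduct.map_tmul] at h1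
    simp only [HopfData.twist, LinearMap.comp_apply, ← h1]
    exact (LinearMap.congr_fun h2 _).symm
  map_one := hf.map_one
  map_comul x := by
    have h1 := LinearMap.congr_fun (hf.isHom.map_scale hA σ⁻¹) (A.comul x)
    simp only [LinearMap.comp_apply] at h1
    simp only [HopfData.twist, LinearMap.comp_apply, h1, hf.map_comul]
  map_counit := hf.map_counit

end HopfData

namespace YDData

variable {k Γ V W : Type*} [Field k] [CommGroup Γ] [AddCommGroup V] [Module k V]
  [AddCommGroup W] [Module k W]

/-! ### The tensor algebra: words, degrees and the action -/

theorem tensorAlgebra_act_one (M : YDData k Γ V) (g : Γ) : M.tensorAlgebra.act g 1 = 1 := by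
  simp [tensorAlgebra]

theorem tensorAlgebra_act_mul (M : YDData k Γ V) (g : Γ) (x y : TensorAlgebra k V) :
    M.tensorAlgebra.act g (x * y) = M.tensorAlgebra.act g x * M.tensorAlgebra.act g y := by
  simp [tensorAlgebra]

theorem tensorAlgebra_act_ι (M : YDData k Γ V) (g : Γ) (v : V) :
    M.tensorAlgebra.act g (TensorAlgebra.ι k v) = TensorAlgebra.ι k (M.act g v) := by
  simp [tensorAlgebra]

theorem deg_tensorAlgebra_one (M : YDData k Γ V) : M.tensorAlgebra.Deg 1 1 := by
  simp [Deg, tensorAlgebra, Algebra.TensorProduct.one_def, MonoidAlgebra.one_def]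

theorem Deg.mul {M : YDData k Γ V} {g h : Γ} {x y : TensorAlgebra k V}
    (hx : M.tensorAlgebra.Deg g x) (hy : M.tensorAlgebra.Deg h y) :
    M.tensorAlgebra.Deg (g * h) (x * y) := by
  simp only [Deg, tensorAlgebra, AlgHom.toLinearMap_apply] at *
  simp [hx, hy, MonoidAlgebra.single_mul_single]

theorem Deg.ι {M : YDData k Γ V} {g : Γ} {v : V} (hv : M.Deg g v) :
    M.tensorAlgebra.Deg g (TensorAlgebra.ι k v) := by
  unfold Deg at *
  simp [tensorAlgebra, hv]

/-- `M.Word n g x` means that `x` is a product of `n` homogeneous elements of `V`, the product of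
whose degrees is `g`. -/
inductive Word (M : YDData k Γ V) : ℕ → Γ → TensorAlgebra k V → Prop
  | one : Word M 0 1 1
  | cons {n : ℕ} {g h : Γ} {v : V} {x : TensorAlgebra k V} (hv : M.Deg g v) (hx : Word M n h x) :
    Word M (n + 1) (g * h) (TensorAlgebra.ι k v * x)

theorem Word.deg {M : YDData k Γ V} {n : ℕ} {g : Γ} {x : TensorAlgebra k V} (hx : M.Word n g x) :
    M.tensorAlgebra.Deg g x := by
  induction hx with
  | one => exact M.deg_tensorAlgebra_one
  | cons hv _ ih => exact hv.ι.mul ih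

theorem eq_top_of_mul_ι_mem {S : Submodule k (TensorAlgebra k V)} (h1 : 1 ∈ S)
    (h : ∀ x ∈ S, ∀ v, x * TensorAlgebra.ι k v ∈ S) : S = ⊤ := by
  rw [eq_top_iff]
  rintro x -
  suffices ∀ y ∈ S, y * x ∈ S by simpa using this 1 h1
  induction x using TensorAlgebra.induction with
  | algebraMap r =>
    intro y hy
    rw [← Algebra.commutes, ← Algebra.smul_def]
    exact S.smul_mem r hy
  | ι v => exact fun y hy => h y hy v
  | mul a b ha hb => exact fun y hy => by rw [← mul_assoc]; exact hb _ (ha y hy)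
  | add a b ha hb => exact fun y hy => by rw [mul_add]; exact S.add_mem (ha y hy) (hb y hy)

/-- By induction on `x`, left multiplication by any `x` preserves `S`; apply this to `1 ∈ S`. -/
theorem eq_top_of_ι_mul_mem {S : Submodule k (TensorAlgebra k V)} (h1 : 1 ∈ S)
    (h : ∀ x ∈ S, ∀ v, TensorAlgebra.ι k v * x ∈ S) : S = ⊤ := by
  rw [eq_top_iff]
  rintro x -
  suffices ∀ y ∈ S, x * y ∈ S by simpa using this 1 h1
  induction x using TensorAlgebra.induction with
  | algebraMap r =>
    intro y hy
    rw [← Algebra.smul_def]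
    exact S.smul_mem r hy
  | ι v => exact fun y hy => h y hy v
  | mul a b ha hb => exact fun y hy => by rw [mul_assoc]; exact ha _ (hb y hy)
  | add a b ha hb => exact fun y hy => by rw [add_mul]; exact S.add_mem (ha y hy) (hb y hy)

theorem ι_mul_mem_of_homog {M : YDData k Γ V} (hM : M.Homog)
    {S : Submodule k (TensorAlgebra k V)} {x : TensorAlgebra k V}
    (h : ∀ g v, M.Deg g v → TensorAlgebra.ι k v * x ∈ S) (v : V) :
    TensorAlgebra.ι k v * x ∈ S := by
  induction v using hM.induction with
  | h0 => simp
  | hadd v w hv hw => rw [map_add, add_mul]; exact S.add_mem hv hw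
  | h g v hv => exact h g v hv

theorem span_word {M : YDData k Γ V} (hM : M.Homog) :
    Submodule.span k {x | ∃ n g, M.Word n g x} = ⊤ := by
  refine eq_top_of_ι_mul_mem (Submodule.subset_span ⟨0, 1, Word.one⟩) fun x hx v => ?_
  induction hx using Submodule.span_induction with
  | zero => simp
  | add x y _ _ hx hy => rw [mul_add]; exact Submodule.add_mem _ hx hy
  | smul c x _ hx => rw [mul_smul_comm]; exact Submodule.smul_mem _ c hx
  | mem x hx =>
    obtain ⟨n, h, hx⟩ := hx
    refine ι_mul_mem_of_homog hM (fun g v hv => ?_) v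
    exact Submodule.subset_span ⟨n + 1, g * h, Word.cons hv hx⟩

theorem pow_le_span_word {M : YDData k Γ V} (hM : M.Homog) (n : ℕ) :
    LinearMap.range (TensorAlgebra.ι k (M := V)) ^ n ≤
      Submodule.span k {x | ∃ g, M.Word n g x} := by
  induction n with
  | zero =>
    rw [pow_zero, Submodule.one_le]
    exact Submodule.subset_span ⟨1, Word.one⟩
  | succ n ih =>
    rw [pow_succ', Submodule.mul_le]
    rintro _ ⟨v, rfl⟩ x hx
    replace hx := ih hx
    induction hx using Submodule.span_induction with
    | zero => simp
    | add x y _ _ hx hy => rw [mul_add]; exact Submodule.add_mem _ hx hy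
    | smul c x _ hx => rw [mul_smul_comm]; exact Submodule.smul_mem _ c hx
    | mem x hx =>
      obtain ⟨h, hx⟩ := hx
      refine ι_mul_mem_of_homog hM (fun g v hv => ?_) v
      exact Submodule.subset_span ⟨g * h, Word.cons hv hx⟩

theorem tensorAlgebra_homog {M : YDData k Γ V} (hM : M.Homog) : M.tensorAlgebra.Homog := by
  unfold Homog
  rw [eq_top_iff, ← span_word hM]
  refine Submodule.span_mono ?_
  rintro x ⟨n, g, hx⟩
  exact ⟨g, hx.deg⟩

/-- This is the main induction principle for `T(V)`: words in homogeneous letters span, and the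
inductive step peels off one letter on the left while the degree of the remaining word stays
available. -/
theorem word_ext {M : YDData k Γ V} (hM : M.Homog) {f f' : TensorAlgebra k V →ₗ[k] W}
    (h1 : f 1 = f' 1)
    (h : ∀ g v h x, M.Deg g v → M.tensorAlgebra.Deg h x → f x = f' x →
      f (TensorAlgebra.ι k v * x) = f' (TensorAlgebra.ι k v * x)) : f = f' := by
  refine LinearMap.ext_on (span_word hM) ?_
  rintro x ⟨n, g, hx⟩
  induction hx with
  | one => exact h1
  | cons hv hx ih => exact h _ _ _ _ hv hx.deg ih

theorem act_mem_pow (M : YDData k Γ V) (g : Γ) {n : ℕ} {x : TensorAlgebra k V}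
    (hx : x ∈ LinearMap.range (TensorAlgebra.ι k (M := V)) ^ n) :
    M.tensorAlgebra.act g x ∈ LinearMap.range (TensorAlgebra.ι k (M := V)) ^ n := by
  have h := Submodule.mem_map_of_mem
    (f := (TensorAlgebra.lift k (TensorAlgebra.ι k ∘ₗ M.act g)).toLinearMap) hx
  rw [Submodule.map_pow] at h
  have hle : (LinearMap.range (TensorAlgebra.ι k (M := V))).map
      (TensorAlgebra.lift k (TensorAlgebra.ι k ∘ₗ M.act g)).toLinearMap ≤
      LinearMap.range (TensorAlgebra.ι k (M := V)) := by
    rw [Submodule.map_le_iff_le_comap]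
    rintro _ ⟨v, rfl⟩
    exact ⟨M.act g v, by simp⟩
  have hle' := pow_le_pow_left' hle n
  exact hle' h

theorem mem_pow_of_word {M : YDData k Γ V} (hM : M.Homog)
    {f : TensorAlgebra k V →ₗ[k] TensorAlgebra k V} (h1 : f 1 = 1)
    (h : ∀ n g v h x, M.Deg g v → M.tensorAlgebra.Deg h x →
      f x ∈ LinearMap.range (TensorAlgebra.ι k (M := V)) ^ n →
      f (TensorAlgebra.ι k v * x) ∈ LinearMap.range (TensorAlgebra.ι k (M := V)) ^ (n + 1))
    {n : ℕ} {x : TensorAlgebra k V} (hx : x ∈ LinearMap.range (TensorAlgebra.ι k (M := V)) ^ n) :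
    f x ∈ LinearMap.range (TensorAlgebra.ι k (M := V)) ^ n := by
  suffices Submodule.span k {x | ∃ g, M.Word n g x} ≤
      (LinearMap.range (TensorAlgebra.ι k (M := V)) ^ n).comap f from
    this (pow_le_span_word hM n hx)
  clear hx
  rw [Submodule.span_le]
  rintro x ⟨g, hx⟩
  rw [SetLike.mem_coe, Submodule.mem_comap]
  induction hx with
  | one => rw [h1, pow_zero]; exact Submodule.one_le.1 le_rfl
  | cons hv hx ih => exact h _ _ _ _ _ hv hx.deg ih

theorem IsYD.tensorAlgebra {M : YDData k Γ V} (hM : M.IsYD) : M.tensorAlgebra.IsYD := by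
  have hT := tensorAlgebra_homog hM.homog
  have hcompat : ∀ g : Γ, M.tensorAlgebra.coact ∘ₗ M.tensorAlgebra.act g =
      (M.tensorAlgebra.act g).lTensor (MonoidAlgebra k Γ) ∘ₗ M.tensorAlgebra.coact := by
    intro g
    refine word_ext hM.homog ?_ fun h v h' x hv hx ih => ?_
    · have := M.deg_tensorAlgebra_one
      unfold Deg at this
      simp [tensorAlgebra_act_one, this]
    · have h1 := hv.ι.mul hx
      -- For homogeneous `x` the induction hypothesis says exactly that `g • x` has the same degree
      -- as `x`.
      have h2 : M.tensorAlgebra.Deg h' (M.tensorAlgebra.act g x) := by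
        unfold Deg at hx ⊢
        simpa [hx] using ih
      have h3 := (hM.deg_act g hv).ι.mul h2
      unfold Deg at h1 h3
      simp [tensorAlgebra_act_mul, tensorAlgebra_act_ι, h1, h3]
  refine isYD_of_homog hT ?_ (fun g h => ?_) hcompat
  · refine word_ext hM.homog (by simp [tensorAlgebra_act_one]) fun h v h' x hv hx ih => ?_
    rw [tensorAlgebra_act_mul, tensorAlgebra_act_ι, ih, hM.act_one]
    rfl
  · refine word_ext hM.homog (by simp [tensorAlgebra_act_one]) fun h v h' x hv hx ih => ?_
    simp [tensorAlgebra_act_mul, tensorAlgebra_act_ι, ih, hM.act_mul]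

theorem IsYD.act_mul_apply {M : YDData k Γ V} (hM : M.IsYD) (g h : Γ) (v : V) :
    M.act (g * h) v = M.act g (M.act h v) := by
  rw [hM.act_mul]; rfl

theorem IsYD.act_comm {M : YDData k Γ V} (hM : M.IsYD) (g h : Γ) (v : V) :
    M.act g (M.act h v) = M.act h (M.act g v) := by
  rw [← hM.act_mul_apply, mul_comm, hM.act_mul_apply]

theorem IsYD.act_inv_act {M : YDData k Γ V} (hM : M.IsYD) (g : Γ) (v : V) :
    M.act g⁻¹ (M.act g v) = v := by
  rw [← hM.act_mul_apply, inv_mul_cancel, hM.act_one]; rfl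

theorem IsYD.act_act_inv {M : YDData k Γ V} (hM : M.IsYD) (g : Γ) (v : V) :
    M.act g (M.act g⁻¹ v) = v := by
  rw [← hM.act_mul_apply, mul_inv_cancel, hM.act_one]; rfl

/-! ### The comultiplication of the tensor algebra -/

/-- Left multiplication by `v ⊗ 1 + 1 ⊗ v` on the braided tensor product `T(V) ⊗ T(V)`, for `v` of
degree `g`. -/
def primMul (M : YDData k Γ V) (g : Γ) (v : V) :
    TensorAlgebra k V ⊗[k] TensorAlgebra k V →ₗ[k] TensorAlgebra k V ⊗[k] TensorAlgebra k V :=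
  TensorProduct.map (LinearMap.mulLeft k (TensorAlgebra.ι k v)) LinearMap.id +
    TensorProduct.map (M.tensorAlgebra.act g) (LinearMap.mulLeft k (TensorAlgebra.ι k v))

theorem primMul_tmul (M : YDData k Γ V) (g : Γ) (v : V) (a b : TensorAlgebra k V) :
    M.primMul g v (a ⊗ₜ b) = (TensorAlgebra.ι k v * a) ⊗ₜ b +
      M.tensorAlgebra.act g a ⊗ₜ (TensorAlgebra.ι k v * b) := by
  simp [primMul]

theorem tensorComul_one (M : YDData k Γ V) : M.tensorComul 1 = 1 ⊗ₜ 1 := by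
  simp [tensorComul]

/-- The definition of the comultiplication by successive left multiplications becomes a recursion on
words. The axiom `act 1 = id` enters in `(v ⊗ 1) (a ⊗ b) = v a ⊗ b`, where the unit is braided past
`a`. -/
theorem IsYD.tensorComul_ι_mul {M : YDData k Γ V} (hM : M.IsYD) {g : Γ} {v : V}
    (hv : M.Deg g v) (x : TensorAlgebra k V) :
    M.tensorComul (TensorAlgebra.ι k v * x) = M.primMul g v (M.tensorComul x) := by
  have key : TensorProduct.curry
      (M.tensorAlgebra.tensorMul (LinearMap.mul' k (TensorAlgebra k V)))
      (TensorAlgebra.ι k v ⊗ₜ 1 + 1 ⊗ₜ TensorAlgebra.ι k v) = M.primMul g v := by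
    refine TensorProduct.ext' fun a b => ?_
    have h1 := hM.tensorAlgebra.act_one
    simp [primMul_tmul, tensorMul_tmul _ _ hv.ι,
      tensorMul_tmul _ _ M.deg_tensorAlgebra_one, h1]
  rw [← key]
  simp [tensorComul]

theorem IsYD.tensorComul_ι {M : YDData k Γ V} (hM : M.IsYD) {g : Γ} {v : V} (hv : M.Deg g v) :
    M.tensorComul (TensorAlgebra.ι k v) =
      TensorAlgebra.ι k v ⊗ₜ 1 + 1 ⊗ₜ TensorAlgebra.ι k v := by
  have := hM.tensorComul_ι_mul hv 1
  rw [mul_one, tensorComul_one, primMul_tmul, tensorAlgebra_act_one, mul_one] at this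
  exact this

theorem IsYD.tensorComul_coassoc {M : YDData k Γ V} (hM : M.IsYD)
    (hact : ∀ g x, M.tensorComul (M.tensorAlgebra.act g x) =
      TensorProduct.map (M.tensorAlgebra.act g) (M.tensorAlgebra.act g) (M.tensorComul x)) :
    (TensorProduct.assoc k _ _ _).toLinearMap ∘ₗ M.tensorComul.rTensor _ ∘ₗ M.tensorComul =
      M.tensorComul.lTensor _ ∘ₗ M.tensorComul := by
  refine word_ext hM.homog (by simp [tensorComul_one]) fun g v h x hv hx ih => ?_
  -- Left multiplication by `v ⊗ 1 ⊗ 1 + 1 ⊗ v ⊗ 1 + 1 ⊗ 1 ⊗ v` in the triple braided tensor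
  -- product. Both iterated comultiplications intertwine `primMul` with it, so they agree on `v x`
  -- once they agree on `x`.
  let L3 : TensorAlgebra k V ⊗[k] (TensorAlgebra k V ⊗[k] TensorAlgebra k V) →ₗ[k]
      TensorAlgebra k V ⊗[k] (TensorAlgebra k V ⊗[k] TensorAlgebra k V) :=
    TensorProduct.map (LinearMap.mulLeft k (TensorAlgebra.ι k v)) LinearMap.id +
      TensorProduct.map (M.tensorAlgebra.act g) (M.primMul g v)
  have h1 : (TensorProduct.assoc k _ _ _).toLinearMap ∘ₗ M.tensorComul.rTensor _ ∘ₗ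
      M.primMul g v = L3 ∘ₗ (TensorProduct.assoc k _ _ _).toLinearMap ∘ₗ
      M.tensorComul.rTensor _ := by
    refine TensorProduct.ext' fun a b => ?_
    simp only [LinearMap.comp_apply, primMul_tmul, map_add, LinearMap.rTensor_tmul,
      hM.tensorComul_ι_mul hv, hact]
    induction M.tensorComul a with
    | zero => simp
    | add x y hx hy =>
      simp only [map_add, TensorProduct.add_tmul] at hx hy ⊢
      rw [← hx, ← hy]; abel
    | tmul c d => simp [L3, primMul_tmul, TensorProduct.add_tmul, TensorProduct.tmul_add, add_assoc]
  have h2 : M.tensorComul.lTensor _ ∘ₗ M.primMul g v = L3 ∘ₗ M.tensorComul.lTensor _ := by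
    refine TensorProduct.ext' fun a b => ?_
    simp [L3, primMul_tmul, hM.tensorComul_ι_mul hv]
  have h1' := LinearMap.congr_fun h1 (M.tensorComul x)
  have h2' := LinearMap.congr_fun h2 (M.tensorComul x)
  simp only [LinearMap.comp_apply] at h1' h2' ih ⊢
  rw [hM.tensorComul_ι_mul hv, h1', h2', ih]

theorem IsYD.tensorComul_act {M : YDData k Γ V} (hM : M.IsYD) (g : Γ) (x : TensorAlgebra k V) :
    M.tensorComul (M.tensorAlgebra.act g x) =
      TensorProduct.map (M.tensorAlgebra.act g) (M.tensorAlgebra.act g) (M.tensorComul x) := by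
  refine LinearMap.congr_fun (f := M.tensorComul ∘ₗ M.tensorAlgebra.act g)
    (g := TensorProduct.map (M.tensorAlgebra.act g) (M.tensorAlgebra.act g) ∘ₗ M.tensorComul) ?_ x
  refine word_ext hM.homog (by simp [tensorComul_one, tensorAlgebra_act_one])
    fun h v h' x hv hx ih => ?_
  simp only [LinearMap.comp_apply] at ih ⊢
  rw [tensorAlgebra_act_mul, tensorAlgebra_act_ι, hM.tensorComul_ι_mul (hM.deg_act g hv), ih,
    hM.tensorComul_ι_mul hv]
  induction M.tensorComul x with
  | zero => simp
  | add x y hx hy => simp only [map_add, hx, hy]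
  | tmul c d =>
    -- The commutativity of `Γ` is essential here: the action of `h` that comes from the braiding is
    -- moved past that of `g`.
    simp [primMul_tmul, tensorAlgebra_act_mul, tensorAlgebra_act_ι, hM.tensorAlgebra.act_comm h g]

theorem IsYD.tensorComul_isHom {M : YDData k Γ V} (hM : M.IsYD) :
    M.tensorAlgebra.IsHom (M.tensorAlgebra.tensor M.tensorAlgebra) M.tensorComul := by
  have hT := hM.tensorAlgebra.homog
  refine ⟨fun g => LinearMap.ext fun x => hM.tensorComul_act g x, ?_⟩
  refine word_ext hM.homog ?_ fun g v h x hv hx ih => ?_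
  · have h1 := M.deg_tensorAlgebra_one
    have h2 := h1.tmul h1
    rw [mul_one] at h2
    unfold Deg at h1 h2
    simp [tensorComul_one, h1, h2]
  · have h1 : (M.tensorAlgebra.tensor M.tensorAlgebra).coact ∘ₗ M.primMul g v =
        TensorProduct.map (LinearMap.mulLeft k (MonoidAlgebra.single g 1)) (M.primMul g v) ∘ₗ
          (M.tensorAlgebra.tensor M.tensorAlgebra).coact := by
      refine hT.ext₂ hT fun a x hx b y hy => ?_
      have h1 := (hv.ι.mul hx).tmul hy
      have h2 := (hM.tensorAlgebra.deg_act g hx).tmul (hv.ι.mul hy)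
      rw [mul_assoc] at h1
      -- The two summands of `primMul` land in degrees `(g a) b` and `a (g b)`; in the abelian group
      -- `Γ` both equal `g (a b)`, so `primMul` shifts the total degree by `g`.
      rw [mul_left_comm] at h2
      have h3 := hx.tmul hy
      unfold Deg at h1 h2 h3
      simp [primMul_tmul, h1, h2, h3, MonoidAlgebra.single_mul_single, TensorProduct.tmul_add]
    have h2 := LinearMap.congr_fun h1 (M.tensorComul x)
    have h3 := hv.ι.mul hx
    unfold Deg at hx h3
    simp only [LinearMap.comp_apply] at h2 ih ⊢
    rw [hM.tensorComul_ι_mul hv, h2, ih, hx, h3]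
    simp [hM.tensorComul_ι_mul hv, MonoidAlgebra.single_mul_single]

theorem IsYD.tensorComul_mul {M : YDData k Γ V} (hM : M.IsYD) (x y : TensorAlgebra k V) :
    M.tensorComul (x * y) = M.tensorAlgebra.tensorMul (LinearMap.mul' k (TensorAlgebra k V))
      (M.tensorComul x ⊗ₜ M.tensorComul y) := by
  have hT := hM.tensorAlgebra
  refine LinearMap.congr_fun (f := M.tensorComul ∘ₗ LinearMap.mulRight k y)
    (g := M.tensorAlgebra.tensorMul (LinearMap.mul' k (TensorAlgebra k V)) ∘ₗ
      (TensorProduct.mk k _ _).flip (M.tensorComul y) ∘ₗ M.tensorComul) ?_ x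
  refine word_ext hM.homog ?_ fun g v h x hv hx ih => ?_
  · simp only [LinearMap.comp_apply, tensorComul_one, LinearMap.mulRight_apply, one_mul,
      LinearMap.flip_apply, TensorProduct.mk_apply]
    induction M.tensorComul y with
    | zero => simp
    | add x y hx hy => rw [TensorProduct.tmul_add, map_add, ← hx, ← hy]
    | tmul c d => simp [tensorMul_tmul _ _ M.deg_tensorAlgebra_one, hT.act_one]
  -- The instance of associativity of the braided tensor product that is needed: the left factor is
  -- the primitive element `v ⊗ 1 + 1 ⊗ v`.
  · have key : ∀ z w, M.tensorAlgebra.tensorMul (LinearMap.mul' k (TensorAlgebra k V))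
        (M.primMul g v z ⊗ₜ w) = M.primMul g v
          (M.tensorAlgebra.tensorMul (LinearMap.mul' k (TensorAlgebra k V)) (z ⊗ₜ w)) := by
      intro z w
      induction w with
      | zero => simp
      | add x y hx hy => simp only [TensorProduct.tmul_add, map_add, hx, hy]
      | tmul c d =>
        induction z with
        | zero => simp
        | add x y hx hy => simp only [TensorProduct.add_tmul, map_add, hx, hy]
        | tmul a b =>
          induction b using hT.homog.induction with
          | h0 => simp
          | hadd x y hx hy =>
            simp only [TensorProduct.tmul_add, TensorProduct.add_tmul, map_add, hx, hy]
          | h h b hb =>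
            rw [primMul_tmul, TensorProduct.add_tmul, map_add, tensorMul_tmul _ _ hb,
              tensorMul_tmul _ _ hb, tensorMul_tmul _ _ (hv.ι.mul hb)]
            simp [primMul_tmul, tensorAlgebra_act_mul, hT.act_mul_apply, mul_assoc]
    simp only [LinearMap.comp_apply, LinearMap.mulRight_apply, LinearMap.flip_apply,
      TensorProduct.mk_apply] at ih ⊢
    rw [mul_assoc, hM.tensorComul_ι_mul hv, ih, hM.tensorComul_ι_mul hv, key]

end YDData

namespace YDData

variable {k Γ V W : Type*} [Field k] [CommGroup Γ] [AddCommGroup V] [Module k V]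
  [AddCommGroup W] [Module k W]

/-! ### The antipode of the tensor algebra -/

/-- The antipode `S` of `T(V)`: `S (v x) = - (g • S x) v` for `v ∈ V` of degree `g`. -/
def antipode (M : YDData k Γ V) : TensorAlgebra k V →ₗ[k] TensorAlgebra k V :=
  LinearMap.applyₗ 1 ∘ₗ (TensorAlgebra.lift k (A := Module.End k (TensorAlgebra k V))
    (-TensorProduct.curry (LinearMap.mul' k (TensorAlgebra k V) ∘ₗ
      M.tensorAlgebra.braiding M.tensorAlgebra) ∘ₗ TensorAlgebra.ι k)).toLinearMap

/-- The Yetter-Drinfeld datum with inverted action. -/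
def invAct (M : YDData k Γ V) : YDData k Γ V where
  act g := M.act g⁻¹
  coact := M.coact

/-- The inverse of the braiding: `v ⊗ w ↦ w ⊗ h⁻¹ • v` for `w` of degree `h`. -/
def braidingInv (M : YDData k Γ V) : V ⊗[k] V →ₗ[k] V ⊗[k] V :=
  (TensorProduct.comm k V V).toLinearMap ∘ₗ M.invAct.braiding M.invAct ∘ₗ
    (TensorProduct.comm k V V).toLinearMap

theorem braidingInv_tmul (M : YDData k Γ V) {h : Γ} (v : V) {w : V} (hw : M.Deg h w) :
    M.braidingInv (v ⊗ₜ w) = w ⊗ₜ M.act h⁻¹ v := by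
  have h1 := M.invAct.braiding_tmul M.invAct (g := h) (v := w) hw v
  simp only [braidingInv, LinearMap.comp_apply, LinearEquiv.coe_coe, TensorProduct.comm_tmul, h1]
  rfl

/-- The inverse `S'` of the antipode of `T(V)`: `S' (v x) = - S'(x) (h⁻¹ • v)` for `v ∈ V` and
`x` of degree `h`. -/
def antipodeInv (M : YDData k Γ V) : TensorAlgebra k V →ₗ[k] TensorAlgebra k V :=
  LinearMap.applyₗ 1 ∘ₗ (TensorAlgebra.lift k (A := Module.End k (TensorAlgebra k V))
    (-TensorProduct.curry (LinearMap.mul' k (TensorAlgebra k V) ∘ₗ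
      M.tensorAlgebra.braidingInv) ∘ₗ TensorAlgebra.ι k)).toLinearMap

theorem antipode_one (M : YDData k Γ V) : M.antipode 1 = 1 := by
  simp [antipode]

theorem antipodeInv_one (M : YDData k Γ V) : M.antipodeInv 1 = 1 := by
  simp [antipodeInv]

theorem antipode_ι_mul (M : YDData k Γ V) {g : Γ} {v : V} (hv : M.Deg g v)
    (x : TensorAlgebra k V) : M.antipode (TensorAlgebra.ι k v * x) =
      -(M.tensorAlgebra.act g (M.antipode x) * TensorAlgebra.ι k v) := by
  simp [antipode, braiding_tmul _ _ hv.ι]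

theorem antipode_ι (M : YDData k Γ V) {g : Γ} {v : V} (hv : M.Deg g v) :
    M.antipode (TensorAlgebra.ι k v) = -TensorAlgebra.ι k v := by
  simpa [antipode_one, tensorAlgebra_act_one] using M.antipode_ι_mul hv 1

/-- The recursion applies the inverse braiding to `v ⊗ S'(x)`, so it is the degree of `S'(x)` that
must be known. That this is the degree of `x` is proved afterwards, by induction with this very
formula. -/
theorem antipodeInv_ι_mul_of_deg (M : YDData k Γ V) {h : Γ} (v : V)
    {x : TensorAlgebra k V} (hx : M.tensorAlgebra.Deg h (M.antipodeInv x)) :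
    M.antipodeInv (TensorAlgebra.ι k v * x) =
      -(M.antipodeInv x * TensorAlgebra.ι k (M.act h⁻¹ v)) := by
  unfold antipodeInv at *
  simp only [LinearMap.comp_apply, AlgHom.toLinearMap_apply, map_mul, TensorAlgebra.lift_ι_apply,
    LinearMap.applyₗ_apply_apply, Module.End.mul_apply] at hx ⊢
  simp [braidingInv_tmul _ _ hx, tensorAlgebra_act_ι]

/-- Preservation of degrees is equivalent to commutation with the coaction, which is an identity of
linear maps and can be tested on words. -/
theorem IsYD.deg_map {M : YDData k Γ V} (hM : M.IsYD)
    {f : TensorAlgebra k V →ₗ[k] TensorAlgebra k V}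
    (h1 : f 1 = 1)
    (h : ∀ g v h x, M.Deg g v → M.tensorAlgebra.Deg h x → M.tensorAlgebra.Deg h (f x) →
      M.tensorAlgebra.Deg (g * h) (f (TensorAlgebra.ι k v * x))) {g : Γ} {x : TensorAlgebra k V}
    (hx : M.tensorAlgebra.Deg g x) : M.tensorAlgebra.Deg g (f x) := by
  have key : M.tensorAlgebra.coact ∘ₗ f =
      f.lTensor (MonoidAlgebra k Γ) ∘ₗ M.tensorAlgebra.coact := by
    refine word_ext hM.homog ?_ fun g v h' x hv hx ih => ?_
    · have := M.deg_tensorAlgebra_one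
      unfold Deg at this
      simp [this, h1]
    · have h3 := hv.ι.mul hx
      have h2 := h g v h' x hv hx (by
        unfold Deg at hx ⊢
        simpa [hx] using ih)
      unfold Deg at h2 h3
      simp [h2, h3]
  have := LinearMap.congr_fun key x
  unfold Deg at *
  simpa [hx] using this

theorem IsYD.deg_antipode {M : YDData k Γ V} (hM : M.IsYD) {g : Γ} {x : TensorAlgebra k V}
    (hx : M.tensorAlgebra.Deg g x) : M.tensorAlgebra.Deg g (M.antipode x) := by
  refine hM.deg_map M.antipode_one (fun g v h x hv hx ih => ?_) hx
  rw [M.antipode_ι_mul hv, mul_comm g h]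
  exact ((hM.tensorAlgebra.deg_act g ih).mul hv.ι).neg

theorem IsYD.deg_antipodeInv {M : YDData k Γ V} (hM : M.IsYD) {g : Γ} {x : TensorAlgebra k V}
    (hx : M.tensorAlgebra.Deg g x) : M.tensorAlgebra.Deg g (M.antipodeInv x) := by
  refine hM.deg_map M.antipodeInv_one (fun g v h x hv hx ih => ?_) hx
  rw [M.antipodeInv_ι_mul_of_deg v ih, mul_comm g h]
  exact (ih.mul (hM.deg_act _ hv).ι).neg

theorem IsYD.antipodeInv_ι_mul {M : YDData k Γ V} (hM : M.IsYD) {h : Γ} (v : V)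
    {x : TensorAlgebra k V} (hx : M.tensorAlgebra.Deg h x) :
    M.antipodeInv (TensorAlgebra.ι k v * x) =
      -(M.antipodeInv x * TensorAlgebra.ι k (M.act h⁻¹ v)) :=
  M.antipodeInv_ι_mul_of_deg v (hM.deg_antipodeInv hx)

theorem IsYD.antipode_act {M : YDData k Γ V} (hM : M.IsYD) (g : Γ) (x : TensorAlgebra k V) :
    M.antipode (M.tensorAlgebra.act g x) = M.tensorAlgebra.act g (M.antipode x) := by
  refine LinearMap.congr_fun (f := M.antipode ∘ₗ M.tensorAlgebra.act g)
    (g := M.tensorAlgebra.act g ∘ₗ M.antipode) ?_ x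
  refine word_ext hM.homog (by simp [tensorAlgebra_act_one, antipode_one])
    fun h v h' x hv hx ih => ?_
  simp only [LinearMap.comp_apply] at ih ⊢
  rw [tensorAlgebra_act_mul, tensorAlgebra_act_ι, antipode_ι_mul _ (hM.deg_act g hv), ih,
    antipode_ι_mul _ hv, map_neg, tensorAlgebra_act_mul, tensorAlgebra_act_ι,
    hM.tensorAlgebra.act_comm h g]

/-- Braided anti-multiplicativity, by induction on the length of `x`: both sides acquire a factor
`-v` on the right and an action of `g` on the rest. -/
theorem IsYD.antipode_mul {M : YDData k Γ V} (hM : M.IsYD) {g : Γ} {x : TensorAlgebra k V}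
    (hx : M.tensorAlgebra.Deg g x) (y : TensorAlgebra k V) :
    M.antipode (x * y) = M.tensorAlgebra.act g (M.antipode y) * M.antipode x := by
  -- The action of the degree of `x` is not linear in `x` as written; expressing it through the
  -- braiding makes it so.
  have key : M.antipode ∘ₗ LinearMap.mulRight k y = LinearMap.mul' k (TensorAlgebra k V) ∘ₗ
      M.tensorAlgebra.braiding M.tensorAlgebra ∘ₗ
      (TensorProduct.mk k _ _).flip (M.antipode y) ∘ₗ M.antipode := by
    refine word_ext hM.homog ?_ fun g v h x hv hx ih => ?_
    · simp [antipode_one, braiding_tmul _ _ M.deg_tensorAlgebra_one, hM.tensorAlgebra.act_one]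
    · have h1 := hM.deg_antipode hx
      have h2 := hM.deg_antipode (hv.ι.mul hx)
      simp only [LinearMap.comp_apply, LinearMap.flip_apply, TensorProduct.mk_apply,
        braiding_tmul _ _ h1, braiding_tmul _ _ h2, LinearMap.mulRight_apply,
        LinearMap.mul'_apply] at ih ⊢
      rw [mul_assoc, antipode_ι_mul _ hv, ih, antipode_ι_mul _ hv, tensorAlgebra_act_mul,
        hM.tensorAlgebra.act_mul_apply]
      noncomm_ring
  have := LinearMap.congr_fun key x
  simpa [braiding_tmul _ _ (hM.deg_antipode hx)] using this

/-- By anti-multiplicativity, `S(S'(v x)) = -S(S'(x) (h⁻¹ • v)) = -(h • S(h⁻¹ • v)) S(S'(x)) = v x`,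
where `h` is the degree of `x`. -/
theorem IsYD.antipode_antipodeInv {M : YDData k Γ V} (hM : M.IsYD) (x : TensorAlgebra k V) :
    M.antipode (M.antipodeInv x) = x := by
  refine LinearMap.congr_fun (f := M.antipode ∘ₗ M.antipodeInv) (g := LinearMap.id) ?_ x
  refine word_ext hM.homog (by simp [antipodeInv_one, antipode_one]) fun g v h x hv hx ih => ?_
  simp only [LinearMap.comp_apply, LinearMap.id_apply] at ih ⊢
  rw [hM.antipodeInv_ι_mul v hx, map_neg, hM.antipode_mul (hM.deg_antipodeInv hx), ih,
    M.antipode_ι (hM.deg_act _ hv), map_neg, tensorAlgebra_act_ι, hM.act_act_inv]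
  simp

/-- The image contains `1` and is stable under right multiplication by letters, as `S'(x) v = S'(-(h
• v) x)`. Together with `S S' = id` this yields `S' S = id` without a product formula for `S'`. -/
theorem IsYD.antipodeInv_surjective {M : YDData k Γ V} (hM : M.IsYD) :
    Function.Surjective M.antipodeInv := by
  rw [← LinearMap.range_eq_top]
  refine eq_top_of_mul_ι_mem ⟨1, M.antipodeInv_one⟩ ?_
  rintro _ ⟨x, rfl⟩ v
  induction x using hM.tensorAlgebra.homog.induction with
  | h0 => simp
  | hadd x y hx hy => rw [map_add, add_mul]; exact Submodule.add_mem _ hx hy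
  | h h x hx =>
    refine ⟨-(TensorAlgebra.ι k (M.act h v) * x), ?_⟩
    rw [map_neg, hM.antipodeInv_ι_mul _ hx, hM.act_inv_act, neg_neg]

theorem IsYD.antipodeInv_antipode {M : YDData k Γ V} (hM : M.IsYD) (x : TensorAlgebra k V) :
    M.antipodeInv (M.antipode x) = x := by
  obtain ⟨x, rfl⟩ := hM.antipodeInv_surjective x
  rw [hM.antipode_antipodeInv]

theorem IsYD.antipode_bijective {M : YDData k Γ V} (hM : M.IsYD) :
    Function.Bijective M.antipode :=
  Function.bijective_iff_has_inverse.2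
    ⟨M.antipodeInv, hM.antipodeInv_antipode, hM.antipode_antipodeInv⟩

theorem IsYD.mul_antipode_rTensor {M : YDData k Γ V} (hM : M.IsYD) (x : TensorAlgebra k V) :
    LinearMap.mul' k _ (M.antipode.rTensor _ (M.tensorComul x)) =
      (TensorAlgebra.algebraMapInv (R := k) x) • (1 : TensorAlgebra k V) := by
  refine LinearMap.congr_fun
    (f := LinearMap.mul' k _ ∘ₗ M.antipode.rTensor _ ∘ₗ M.tensorComul)
    (g := (TensorAlgebra.algebraMapInv (R := k)).toLinearMap.smulRight
      (1 : TensorAlgebra k V)) ?_ x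
  refine word_ext hM.homog (by simp [tensorComul_one, antipode_one]) fun g v h x hv _ _ => ?_
  -- The two terms cancel: `S(v a) b = -(g • S a) v b` and `S(g • a) v b = (g • S a) v b`. Hence the
  -- convolution vanishes on every word of positive length.
  have h0 : LinearMap.mul' k _ ∘ₗ M.antipode.rTensor _ ∘ₗ M.primMul g v = 0 := by
    refine TensorProduct.ext' fun a b => ?_
    simp [primMul_tmul, antipode_ι_mul _ hv, hM.antipode_act, mul_assoc]
  have h1 := LinearMap.congr_fun h0 (M.tensorComul x)
  simp only [LinearMap.comp_apply] at h1
  simp [hM.tensorComul_ι_mul hv, h1, TensorAlgebra.algebraMapInv]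

theorem IsYD.mul_antipode_lTensor {M : YDData k Γ V} (hM : M.IsYD) (x : TensorAlgebra k V) :
    LinearMap.mul' k _ (M.antipode.lTensor _ (M.tensorComul x)) =
      (TensorAlgebra.algebraMapInv (R := k) x) • (1 : TensorAlgebra k V) := by
  refine LinearMap.congr_fun
    (f := LinearMap.mul' k _ ∘ₗ M.antipode.lTensor _ ∘ₗ M.tensorComul)
    (g := (TensorAlgebra.algebraMapInv (R := k)).toLinearMap.smulRight
      (1 : TensorAlgebra k V)) ?_ x
  refine word_ext hM.homog (by simp [tensorComul_one, antipode_one]) fun g v h x hv _ ih => ?_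
  -- Passing from `x` to `v x` applies the braided commutator `z ↦ v z - (g • z) v` to `x₁ S(x₂)`.
  -- By induction that element is a scalar multiple of `1`, on which the commutator vanishes.
  have h0 : LinearMap.mul' k _ ∘ₗ M.antipode.lTensor _ ∘ₗ M.primMul g v =
      (LinearMap.mulLeft k (TensorAlgebra.ι k v) -
        LinearMap.mulRight k (TensorAlgebra.ι k v) ∘ₗ M.tensorAlgebra.act g) ∘ₗ
        LinearMap.mul' k _ ∘ₗ M.antipode.lTensor _ := by
    refine TensorProduct.ext' fun a b => ?_
    simp [primMul_tmul, antipode_ι_mul _ hv, tensorAlgebra_act_mul, mul_assoc, sub_eq_add_neg]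
  have h1 := LinearMap.congr_fun h0 (M.tensorComul x)
  simp only [LinearMap.comp_apply] at h1 ih ⊢
  rw [hM.tensorComul_ι_mul hv, h1, ih]
  simp [TensorAlgebra.algebraMapInv, tensorAlgebra_act_one]

/-- The comultiplicative counterpart of `antipode_mul`, `Δ S = (S ⊗ S) c Δ`. It follows by induction
from `S(v x) = -(g • S x) v`, since `Δ` is multiplicative and commutes with the action. It is what
makes the antipode carry coideals to coideals. -/
theorem IsYD.tensorComul_antipode {M : YDData k Γ V} (hM : M.IsYD) (x : TensorAlgebra k V) :
    M.tensorComul (M.antipode x) = TensorProduct.map M.antipode M.antipode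
      (M.tensorAlgebra.braiding M.tensorAlgebra (M.tensorComul x)) := by
  have hT := hM.tensorAlgebra
  refine LinearMap.congr_fun (f := M.tensorComul ∘ₗ M.antipode)
    (g := TensorProduct.map M.antipode M.antipode ∘ₗ
      M.tensorAlgebra.braiding M.tensorAlgebra ∘ₗ M.tensorComul) ?_ x
  refine word_ext hM.homog ?_ fun g v h x hv hx ih => ?_
  · simp [tensorComul_one, antipode_one, braiding_tmul _ _ M.deg_tensorAlgebra_one,
      tensorAlgebra_act_one]
  simp only [LinearMap.comp_apply] at ih ⊢
  rw [antipode_ι_mul _ hv, map_neg, hM.tensorComul_mul, hM.tensorComul_act, ih,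
    hM.tensorComul_ι_mul hv, hM.tensorComul_ι hv]
  induction M.tensorComul x with
  | zero => simp
  | add x y hx hy => simp only [map_add, TensorProduct.add_tmul, neg_add, hx, hy]
  | tmul a b =>
    induction a using hT.homog.induction with
    | h0 => simp
    | hadd x y hx hy => simp only [map_add, TensorProduct.add_tmul, neg_add, hx, hy]
    | h α a ha =>
      have h1 := hT.deg_act g (hM.deg_antipode ha)
      rw [braiding_tmul _ _ ha, primMul_tmul, map_add, braiding_tmul _ _ (hv.ι.mul ha),
        braiding_tmul _ _ (hT.deg_act g ha), TensorProduct.map_tmul, TensorProduct.map_tmul,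
        TensorProduct.tmul_add, map_add, tensorMul_tmul _ _ h1, tensorMul_tmul _ _ h1, map_add,
        TensorProduct.map_tmul, TensorProduct.map_tmul, antipode_ι_mul _ hv,
        tensorAlgebra_act_mul, tensorAlgebra_act_ι, antipode_ι_mul _ (hM.deg_act α hv)]
      simp only [hM.antipode_act, tensorAlgebra_act_one,
        LinearMap.mul'_apply, mul_one, hT.act_mul_apply, TensorProduct.tmul_neg,
        TensorProduct.neg_tmul, neg_add]
      rw [add_comm, hT.act_comm g α]

/-! ### The tensor algebra as a Hopf algebra -/

/-- The tensor algebra as a Hopf algebra in the category of Yetter-Drinfeld modules. -/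
def tensorHopf (M : YDData k Γ V) : HopfData k Γ (TensorAlgebra k V) where
  toYDData := M.tensorAlgebra
  mul := LinearMap.mul' k (TensorAlgebra k V)
  one := 1
  comul := M.tensorComul
  counit := (TensorAlgebra.algebraMapInv (R := k)).toLinearMap

theorem algebraMapInv_ι (v : V) :
    TensorAlgebra.algebraMapInv (R := k) (TensorAlgebra.ι k v) = 0 := by
  simp [TensorAlgebra.algebraMapInv]

theorem IsYD.isAntipode {M : YDData k Γ V} (hM : M.IsYD) :
    M.tensorHopf.IsAntipode M.antipode where
  bijective := hM.antipode_bijective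
  isHom := hM.tensorAlgebra.homog.isHom (fun g _ x _ => hM.antipode_act g x)
    fun _ _ hx => hM.deg_antipode hx
  mul_rTensor := hM.mul_antipode_rTensor
  mul_lTensor := hM.mul_antipode_lTensor

theorem IsYD.tensorHopf_isHopf {M : YDData k Γ V} (hM : M.IsYD) : M.tensorHopf.IsHopf := by
  have hT := hM.tensorAlgebra
  have hact : ∀ g x, TensorAlgebra.algebraMapInv (R := k) (M.tensorAlgebra.act g x) =
      TensorAlgebra.algebraMapInv (R := k) x := fun g => LinearMap.congr_fun
    (f := (TensorAlgebra.algebraMapInv (R := k)).toLinearMap ∘ₗ M.tensorAlgebra.act g)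
    (g := (TensorAlgebra.algebraMapInv (R := k)).toLinearMap)
    (word_ext hM.homog (by simp [tensorAlgebra_act_one]) fun h v h' x hv hx ih => by
      simp [tensorAlgebra_act_mul, tensorAlgebra_act_ι, algebraMapInv_ι])
  constructor
  case isYD => exact hT
  case mul_assoc => exact fun x y z => mul_assoc x y z
  case one_mul => exact fun x => one_mul x
  case mul_one => exact fun x => mul_one x
  case mul_hom =>
    refine ⟨fun g => TensorProduct.ext' fun x y => (M.tensorAlgebra_act_mul g x y).symm, ?_⟩
    refine hT.homog.ext₂ hT.homog fun g x hx h y hy => ?_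
    have h1 := hx.tmul hy
    have h2 := hx.mul hy
    unfold Deg at h1 h2
    simp [tensorHopf, h1, h2]
  case one_hom =>
    refine unit_homog.isHom (fun g h v _ => ?_) fun g v hv => ?_
    · simp [unit, tensorHopf, tensorAlgebra_act_one]
    · have h1 := M.deg_tensorAlgebra_one
      unfold Deg at h1 hv ⊢
      -- The zero scalar has every degree, so `g = 1` cannot be concluded. Pushing `g ⊗ v = 1 ⊗ v`
      -- along `k → T(V)` avoids the case distinction.
      have : MonoidAlgebra.single g (1 : k) ⊗ₜ[k] v = 1 ⊗ₜ v := hv.symm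
      have := congrArg (fun z => (LinearMap.toSpanSingleton k (TensorAlgebra k V) 1).lTensor _ z)
        this
      simp only [LinearMap.lTensor_tmul] at this
      simp [tensorHopf] at this ⊢
      rw [h1, this, MonoidAlgebra.one_def]
  case coassoc => exact hM.tensorComul_coassoc hM.tensorComul_act
  case counit_left =>
    refine word_ext hM.homog (by simp [tensorHopf, tensorComul_one]) fun g v h x hv _ ih => ?_
    have h0 : (TensorProduct.lid k _).toLinearMap ∘ₗ
        (TensorAlgebra.algebraMapInv (R := k)).toLinearMap.rTensor _ ∘ₗ M.primMul g v =
        LinearMap.mulLeft k (TensorAlgebra.ι k v) ∘ₗ (TensorProduct.lid k _).toLinearMap ∘ₗ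
        (TensorAlgebra.algebraMapInv (R := k)).toLinearMap.rTensor _ :=
      TensorProduct.ext' fun a b => by simp [primMul_tmul, algebraMapInv_ι, hact]
    have h1 := LinearMap.congr_fun h0 (M.tensorComul x)
    simp only [LinearMap.comp_apply, tensorHopf, LinearMap.id_apply] at h1 ih ⊢
    rw [hM.tensorComul_ι_mul hv, h1, ih, LinearMap.mulLeft_apply]
  case counit_right =>
    refine word_ext hM.homog (by simp [tensorHopf, tensorComul_one]) fun g v h x hv _ ih => ?_
    have h0 : (TensorProduct.rid k _).toLinearMap ∘ₗ
        (TensorAlgebra.algebraMapInv (R := k)).toLinearMap.lTensor _ ∘ₗ M.primMul g v =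
        LinearMap.mulLeft k (TensorAlgebra.ι k v) ∘ₗ (TensorProduct.rid k _).toLinearMap ∘ₗ
        (TensorAlgebra.algebraMapInv (R := k)).toLinearMap.lTensor _ :=
      TensorProduct.ext' fun a b => by simp [primMul_tmul, algebraMapInv_ι]
    have h1 := LinearMap.congr_fun h0 (M.tensorComul x)
    simp only [LinearMap.comp_apply, tensorHopf, LinearMap.id_apply] at h1 ih ⊢
    rw [hM.tensorComul_ι_mul hv, h1, ih, LinearMap.mulLeft_apply]
  case comul_hom => exact hM.tensorComul_isHom
  case counit_hom =>
    refine ⟨fun g => LinearMap.ext fun x => hact g x, ?_⟩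
    refine word_ext hM.homog ?_ fun g v h x hv hx _ => ?_
    · have h1 := M.deg_tensorAlgebra_one
      unfold Deg at h1
      simp [tensorHopf, h1, unit, MonoidAlgebra.one_def]
    · have h1 := hv.ι.mul hx
      unfold Deg at h1
      simp [tensorHopf, h1, algebraMapInv_ι]
  case comul_mul => exact hM.tensorComul_mul
  case comul_one => exact M.tensorComul_one
  case counit_mul => exact fun x y => by simp [tensorHopf]
  case counit_one => simp [tensorHopf]
  case antipode =>
    have h := hM.isAntipode
    exact ⟨M.antipode, h.bijective, h.isHom, h.mul_rTensor, h.mul_lTensor⟩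

end YDData

namespace YDData

variable {k Γ V W : Type*} [Field k] [CommGroup Γ] [AddCommGroup V] [Module k V]
  [AddCommGroup W] [Module k W]

/-! ### Coideals -/

/-- The subspace `I ⊗ V + V ⊗ I` of `V ⊗ V`. -/
def coideal (I : Submodule k V) : Submodule k (V ⊗[k] V) :=
  LinearMap.range (I.subtype.rTensor V) ⊔ LinearMap.range (I.subtype.lTensor V)

theorem tmul_mem_coideal_left {I : Submodule k V} {a : V} (ha : a ∈ I) (b : V) :
    a ⊗ₜ b ∈ coideal I :=
  Submodule.mem_sup_left ⟨(⟨a, ha⟩ : I) ⊗ₜ b, rfl⟩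

theorem tmul_mem_coideal_right {I : Submodule k V} (a : V) {b : V} (hb : b ∈ I) :
    a ⊗ₜ b ∈ coideal I :=
  Submodule.mem_sup_right ⟨a ⊗ₜ (⟨b, hb⟩ : I), rfl⟩

theorem coideal_le {I : Submodule k V} {P : Submodule k (V ⊗[k] V)}
    (hl : ∀ a ∈ I, ∀ b, a ⊗ₜ b ∈ P) (hr : ∀ a, ∀ b ∈ I, a ⊗ₜ b ∈ P) : coideal I ≤ P := by
  refine sup_le ?_ ?_
  · rintro _ ⟨z, rfl⟩
    induction z with
    | zero => simp
    | add x y hx hy => rw [map_add]; exact P.add_mem hx hy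
    | tmul a b => exact hl a a.2 b
  · rintro _ ⟨z, rfl⟩
    induction z with
    | zero => simp
    | add x y hx hy => rw [map_add]; exact P.add_mem hx hy
    | tmul a b => exact hr a b b.2

/-- `I` is spanned by homogeneous elements. -/
def HomogSub (M : YDData k Γ V) (I : Submodule k V) : Prop :=
  I ≤ Submodule.span k {x | x ∈ I ∧ ∃ g, M.Deg g x}

theorem HomogSub.le {M : YDData k Γ V} {I P : Submodule k V} (hI : M.HomogSub I)
    (h : ∀ g x, M.Deg g x → x ∈ I → x ∈ P) : I ≤ P := by
  refine hI.trans ?_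
  rw [Submodule.span_le]
  rintro x ⟨hx, g, hg⟩
  exact h g x hg hx

theorem Homog.le {M : YDData k Γ V} (hM : M.Homog) {P : Submodule k V}
    (h : ∀ g x, M.Deg g x → x ∈ P) (x : V) : x ∈ P := by
  have : (⊤ : Submodule k V) ≤ P := by
    rw [← hM, Submodule.span_le]
    rintro x ⟨g, hx⟩
    exact h g x hx
  exact this trivial

/-- The braiding, its inverse and the scaling by `σ` have explicit values only on pairs of
homogeneous elements. If `I` is spanned by such elements, these pairs suffice for testing `I ⊗ V + V
⊗ I`. -/
theorem HomogSub.coideal_le {M : YDData k Γ V} (hM : M.Homog) {I : Submodule k V}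
    (hI : M.HomogSub I) {P : Submodule k (V ⊗[k] V)}
    (h : ∀ g a h b, M.Deg g a → M.Deg h b → a ∈ I ∨ b ∈ I → a ⊗ₜ b ∈ P) : coideal I ≤ P := by
  refine YDData.coideal_le (fun a ha b => ?_) fun a b hb => ?_
  · refine hI.le (P := P.comap ((TensorProduct.mk k V V).flip b)) (fun g a hg ha => ?_) ha
    exact hM.le (P := P.comap (TensorProduct.mk k V V a))
      (fun h' b hb => h g a h' b hg hb (Or.inl ha)) b
  · refine hI.le (P := P.comap (TensorProduct.mk k V V a)) (fun g b hg hb => ?_) hb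
    exact hM.le (P := P.comap ((TensorProduct.mk k V V).flip b))
      (fun h' a ha => h h' a g b ha hg (Or.inr hb)) a

theorem HomogSub.map {M : YDData k Γ V} {N : YDData k Γ W} {I : Submodule k V}
    (hI : M.HomogSub I) {f : V →ₗ[k] W} (hf : ∀ g x, M.Deg g x → N.Deg g (f x)) :
    N.HomogSub (I.map f) := by
  unfold HomogSub
  rw [Submodule.map_le_iff_le_comap]
  exact hI.le fun g x hg hx =>
    Submodule.subset_span ⟨Submodule.mem_map_of_mem hx, g, hf g x hg⟩

theorem map_mem_coideal {I : Submodule k V} {f : V →ₗ[k] W} {z : V ⊗[k] V}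
    (hz : z ∈ coideal I) : TensorProduct.map f f z ∈ coideal (I.map f) :=
  coideal_le (P := (coideal (I.map f)).comap (TensorProduct.map f f))
    (fun _ ha b => tmul_mem_coideal_left (Submodule.mem_map_of_mem ha) (f b))
    (fun a _ hb => tmul_mem_coideal_right (f a) (Submodule.mem_map_of_mem hb)) hz

/-! ### Ideals defining pre-Nichols algebras -/

/-- A variant of `IsNicholsIdeal` for subspaces, phrased in terms of homogeneous elements. -/
structure IsNicholsSub (M : YDData k Γ V) (I : Submodule k (TensorAlgebra k V)) : Prop where
  mul_left : ∀ a, ∀ x ∈ I, a * x ∈ I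
  mul_right : ∀ a, ∀ x ∈ I, x * a ∈ I
  graded : ∀ x ∈ I, x ∈ Submodule.span k
    {y | y ∈ I ∧ ∃ n : ℕ, 2 ≤ n ∧ y ∈ LinearMap.range (TensorAlgebra.ι k (M := V)) ^ n}
  act_mem : ∀ g : Γ, ∀ x ∈ I, M.tensorAlgebra.act g x ∈ I
  homog : M.tensorAlgebra.HomogSub I
  comul_mem : ∀ x ∈ I, M.tensorComul x ∈ coideal I

theorem IsNicholsIdeal.isNicholsSub {M : YDData k Γ V} (hM : M.IsYD)
    {I : Ideal (TensorAlgebra k V)} (hI : M.IsNicholsIdeal I) :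
    M.IsNicholsSub (I.restrictScalars k) where
  mul_left a _ hx := I.mul_mem_left a hx
  mul_right a _ hx := hI.isTwoSided.mul_mem_of_left a hx
  graded := hI.graded
  act_mem := hI.act_mem
  homog x hx := hM.tensorAlgebra.mem_span_deg (hI.coact_mem x hx)
  comul_mem := hI.comul_mem

theorem IsNicholsSub.mem_nicholsIdeal {M : YDData k Γ V} {I : Submodule k (TensorAlgebra k V)}
    (hI : M.IsNicholsSub I) {x : TensorAlgebra k V} (hx : x ∈ I) : x ∈ M.nicholsIdeal := by
  let I' : Ideal (TensorAlgebra k V) :=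
    { carrier := I
      add_mem' := I.add_mem
      zero_mem' := I.zero_mem
      smul_mem' := fun a x hx => hI.mul_left a x hx }
  have hI' : I'.restrictScalars k = I := rfl
  refine M.le_nicholsIdeal (I := I') ⟨⟨fun {a} b ha => hI.mul_right b a ha⟩, hI.graded,
    hI.act_mem, fun x hx => ?_, hI.comul_mem⟩ hx
  refine hI.homog.le (P := (LinearMap.range _).comap M.tensorAlgebra.coact)
    (fun g x hg hx => ?_) hx
  rw [Submodule.mem_comap, hg]
  exact ⟨MonoidAlgebra.single g 1 ⊗ₜ (⟨x, hx⟩ : I), rfl⟩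

/-- The defining ideal is a sum, so it is enough to treat each summand. The image of an ideal under
`f` is a priori just a subspace, since `f` will be an antipode or a twist and not an algebra map;
this is why the target condition is `IsNicholsSub`. -/
theorem map_mem_nicholsIdeal {M N : YDData k Γ V}
    {f : TensorAlgebra k V →ₗ[k] TensorAlgebra k V}
    (hf : ∀ I, M.IsNicholsIdeal I → N.IsNicholsSub ((I.restrictScalars k).map f))
    {x : TensorAlgebra k V} (hx : x ∈ M.nicholsIdeal) : f x ∈ N.nicholsIdeal := by
  have h1 : x ∈ (N.nicholsIdeal.restrictScalars k).comap f :=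
    M.nicholsIdeal_induction (fun I hI y hy => by
      rw [Submodule.mem_comap, Submodule.restrictScalars_mem]
      exact (hf I hI).mem_nicholsIdeal
        (Submodule.mem_map_of_mem ((Submodule.restrictScalars_mem k I y).2 hy))) hx
  rwa [Submodule.mem_comap, Submodule.restrictScalars_mem] at h1

/-- A common criterion for the antipode, its inverse and the twist. These maps are multiplicative
only up to actions, order and scalars depending on degrees, so the ideal conditions are required on
homogeneous elements alone. -/
theorem IsNicholsSub.map {M N : YDData k Γ V} (hM : M.IsYD) {I : Submodule k (TensorAlgebra k V)}
    (hI : M.IsNicholsSub I) {φ : TensorAlgebra k V →ₗ[k] TensorAlgebra k V}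
    (hφ : Function.Surjective φ)
    (hpow : ∀ n : ℕ, ∀ x ∈ LinearMap.range (TensorAlgebra.ι k (M := V)) ^ n,
      φ x ∈ LinearMap.range (TensorAlgebra.ι k (M := V)) ^ n)
    (hdeg : ∀ g x, M.tensorAlgebra.Deg g x → N.tensorAlgebra.Deg g (φ x))
    (hact : ∀ g h x, M.tensorAlgebra.Deg h x →
      ∃ c : k, N.tensorAlgebra.act g (φ x) = c • φ (M.tensorAlgebra.act g x))
    (hleft : ∀ g b h x, M.tensorAlgebra.Deg g b → M.tensorAlgebra.Deg h x → x ∈ I →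
      φ b * φ x ∈ I.map φ)
    (hright : ∀ g b h x, M.tensorAlgebra.Deg g b → M.tensorAlgebra.Deg h x → x ∈ I →
      φ x * φ b ∈ I.map φ)
    (hcomul : ∀ x ∈ I, N.tensorComul (φ x) ∈ coideal (I.map φ)) :
    N.IsNicholsSub (I.map φ) where
  mul_left a := by
    obtain ⟨a, rfl⟩ := hφ a
    rintro _ ⟨x, hx, rfl⟩
    refine hI.homog.le (P := ((I.map φ).comap (LinearMap.mulLeft k (φ a))).comap φ)
      (fun h x hg hx => ?_) hx
    exact hM.tensorAlgebra.homog.le (P := ((I.map φ).comap (LinearMap.mulRight k (φ x))).comap φ)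
      (fun g b hb => hleft g b h x hb hg hx) a
  mul_right a := by
    obtain ⟨a, rfl⟩ := hφ a
    rintro _ ⟨x, hx, rfl⟩
    refine hI.homog.le (P := ((I.map φ).comap (LinearMap.mulRight k (φ a))).comap φ)
      (fun h x hg hx => ?_) hx
    exact hM.tensorAlgebra.homog.le (P := ((I.map φ).comap (LinearMap.mulLeft k (φ x))).comap φ)
      (fun g b hb => hright g b h x hb hg hx) a
  graded := by
    rintro _ ⟨x, hx, rfl⟩
    have h1 := Submodule.mem_map_of_mem (f := φ) (hI.graded x hx)
    rw [Submodule.map_span] at h1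
    refine Submodule.span_mono ?_ h1
    rintro _ ⟨y, ⟨hy, n, hn, hyn⟩, rfl⟩
    exact ⟨Submodule.mem_map_of_mem hy, n, hn, hpow n y hyn⟩
  act_mem := by
    rintro g _ ⟨x, hx, rfl⟩
    refine hI.homog.le (P := ((I.map φ).comap (N.tensorAlgebra.act g)).comap φ)
      (fun h x hg hx => ?_) hx
    obtain ⟨c, hc⟩ := hact g h x hg
    rw [Submodule.mem_comap, Submodule.mem_comap, hc]
    exact Submodule.smul_mem _ c (Submodule.mem_map_of_mem (hI.act_mem g x hx))
  homog := hI.homog.map hdeg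
  comul_mem := by
    rintro _ ⟨x, hx, rfl⟩
    exact hcomul x hx

/-! ### The antipode preserves the defining ideal of the Nichols algebra -/

theorem IsYD.antipode_mem_pow {M : YDData k Γ V} (hM : M.IsYD) {n : ℕ} {x : TensorAlgebra k V}
    (hx : x ∈ LinearMap.range (TensorAlgebra.ι k (M := V)) ^ n) :
    M.antipode x ∈ LinearMap.range (TensorAlgebra.ι k (M := V)) ^ n := by
  refine mem_pow_of_word hM.homog M.antipode_one (fun n g v h x hv hx ih => ?_) hx
  rw [antipode_ι_mul _ hv, pow_succ]
  exact Submodule.neg_mem _ (Submodule.mul_mem_mul (M.act_mem_pow g ih) ⟨v, rfl⟩)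

theorem IsYD.antipodeInv_mem_pow {M : YDData k Γ V} (hM : M.IsYD) {n : ℕ} {x : TensorAlgebra k V}
    (hx : x ∈ LinearMap.range (TensorAlgebra.ι k (M := V)) ^ n) :
    M.antipodeInv x ∈ LinearMap.range (TensorAlgebra.ι k (M := V)) ^ n := by
  refine mem_pow_of_word hM.homog M.antipodeInv_one (fun n g v h x hv hx ih => ?_) hx
  rw [hM.antipodeInv_ι_mul v hx, pow_succ]
  exact Submodule.neg_mem _ (Submodule.mul_mem_mul ih ⟨_, rfl⟩)

theorem IsYD.antipodeInv_act {M : YDData k Γ V} (hM : M.IsYD) (g : Γ) (x : TensorAlgebra k V) :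
    M.antipodeInv (M.tensorAlgebra.act g x) = M.tensorAlgebra.act g (M.antipodeInv x) := by
  apply hM.antipode_bijective.1
  rw [hM.antipode_antipodeInv, hM.antipode_act, hM.antipode_antipodeInv]

theorem IsYD.braidingInv_braiding {M : YDData k Γ V} (hM : M.IsYD) (z : V ⊗[k] V) :
    M.braidingInv (M.braiding M z) = z := by
  refine LinearMap.congr_fun (f := M.braidingInv ∘ₗ M.braiding M) (g := LinearMap.id) ?_ z
  refine hM.homog.ext₂ hM.homog fun g v hv h w hw => ?_
  simp [braiding_tmul _ _ hv, braidingInv_tmul _ _ hv, hM.act_inv_act]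

theorem IsNicholsSub.map_antipode {M : YDData k Γ V} (hM : M.IsYD)
    {I : Submodule k (TensorAlgebra k V)} (hI : M.IsNicholsSub I) :
    M.IsNicholsSub (I.map M.antipode) := by
  have hT := hM.tensorAlgebra
  refine hI.map hM hM.antipode_bijective.2 (fun n x hx => hM.antipode_mem_pow hx)
    (fun g x hx => hM.deg_antipode hx)
    (fun g h x _ => ⟨1, by rw [one_smul, hM.antipode_act]⟩) (fun g b h x _ hx hxI => ?_)
    (fun g b h x hb _ hxI => ?_) fun x hx => ?_
  -- Anti-multiplicativity lets `h` act on the image of the second factor; the `h⁻¹` in the witness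
  -- undoes it.
  · refine ⟨x * M.tensorAlgebra.act h⁻¹ b, hI.mul_right _ x hxI, ?_⟩
    rw [hM.antipode_mul hx, ← hM.antipode_act, hT.act_act_inv]
  · refine ⟨b * M.tensorAlgebra.act g⁻¹ x, hI.mul_left _ _ (hI.act_mem _ x hxI), ?_⟩
    rw [hM.antipode_mul hb, ← hM.antipode_act, hT.act_act_inv]
  · rw [hM.tensorComul_antipode]
    refine map_mem_coideal (hI.homog.coideal_le hT.homog
      (P := (coideal I).comap (M.tensorAlgebra.braiding M.tensorAlgebra))
      (fun g a h b ha hb hab => ?_) (hI.comul_mem x hx))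
    -- The braiding maps `I ⊗ T + T ⊗ I` to itself because `I` is stable under the action.
    rw [Submodule.mem_comap, braiding_tmul _ _ ha]
    rcases hab with hab | hab
    · exact tmul_mem_coideal_right _ hab
    · exact tmul_mem_coideal_left (hI.act_mem g b hab) _

theorem IsNicholsSub.map_antipodeInv {M : YDData k Γ V} (hM : M.IsYD)
    {I : Submodule k (TensorAlgebra k V)} (hI : M.IsNicholsSub I) :
    M.IsNicholsSub (I.map M.antipodeInv) := by
  have hT := hM.tensorAlgebra
  have hinv : ∀ y, M.antipode y ∈ I → y ∈ I.map M.antipodeInv := fun y hy =>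
    ⟨_, hy, hM.antipodeInv_antipode y⟩
  refine hI.map hM hM.antipodeInv_surjective (fun n x hx => hM.antipodeInv_mem_pow hx)
    (fun g x hx => hM.deg_antipodeInv hx)
    (fun g h x _ => ⟨1, by rw [one_smul, hM.antipodeInv_act]⟩) (fun g b h x hb _ hxI => hinv _ ?_)
    (fun g b h x _ hx hxI => hinv _ ?_) fun x hx => ?_
  · rw [hM.antipode_mul (hM.deg_antipodeInv hb), hM.antipode_antipodeInv, hM.antipode_antipodeInv]
    exact hI.mul_right _ _ (hI.act_mem g x hxI)
  · rw [hM.antipode_mul (hM.deg_antipodeInv hx), hM.antipode_antipodeInv, hM.antipode_antipodeInv]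
    exact hI.mul_left _ x hxI
  -- Evaluating `Δ S = (S ⊗ S) c Δ` at `S' x` and inverting gives `Δ S' = c⁻¹ (S' ⊗ S') Δ`.
  · have h1 := hM.tensorComul_antipode (M.antipodeInv x)
    rw [hM.antipode_antipodeInv] at h1
    have h2 := congrArg (TensorProduct.map M.antipodeInv M.antipodeInv) h1
    have h3 : M.antipodeInv ∘ₗ M.antipode = LinearMap.id := LinearMap.ext hM.antipodeInv_antipode
    rw [← LinearMap.comp_apply (TensorProduct.map M.antipodeInv M.antipodeInv)
      (TensorProduct.map M.antipode M.antipode), ← TensorProduct.map_comp, h3,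
      TensorProduct.map_id, LinearMap.id_apply] at h2
    rw [← hT.braidingInv_braiding (M.tensorComul (M.antipodeInv x)), ← h2]
    have hI' : M.tensorAlgebra.HomogSub (I.map M.antipodeInv) :=
      hI.homog.map fun g x hx => hM.deg_antipodeInv hx
    refine hI'.coideal_le hT.homog
      (P := (coideal (I.map M.antipodeInv)).comap M.tensorAlgebra.braidingInv)
      (fun g a h b ha hb hab => ?_) (map_mem_coideal (hI.comul_mem x hx))
    rw [Submodule.mem_comap, braidingInv_tmul _ _ hb]
    rcases hab with ⟨a, hab, rfl⟩ | hab
    · refine tmul_mem_coideal_right _ ⟨M.tensorAlgebra.act h⁻¹ a, hI.act_mem _ a hab, ?_⟩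
      rw [hM.antipodeInv_act]
    · exact tmul_mem_coideal_left hab _

theorem IsYD.antipode_mem_nicholsIdeal {M : YDData k Γ V} (hM : M.IsYD) (x : TensorAlgebra k V) :
    M.antipode x ∈ M.nicholsIdeal ↔ x ∈ M.nicholsIdeal := by
  refine ⟨fun hx => ?_, fun hx => ?_⟩
  · rw [← hM.antipodeInv_antipode x]
    exact map_mem_nicholsIdeal (fun I hI => (hI.isNicholsSub hM).map_antipodeInv hM) hx
  · exact map_mem_nicholsIdeal (fun I hI => (hI.isNicholsSub hM).map_antipode hM) hx

/-! ### The Nichols algebra is a Hopf algebra -/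

theorem toNichols_surjective (M : YDData k Γ V) : Function.Surjective M.toNichols :=
  Ideal.Quotient.mk_surjective

theorem toNichols_eq_zero_iff (M : YDData k Γ V) (x : TensorAlgebra k V) :
    M.toNichols x = 0 ↔ x ∈ M.nicholsIdeal :=
  Ideal.Quotient.eq_zero_iff_mem

theorem toNichols_isHopfHom (M : YDData k Γ V) :
    M.tensorHopf.IsHopfHom M.nichols M.toNichols where
  isHom := ⟨fun _ => LinearMap.ext fun _ => rfl, LinearMap.ext fun _ => rfl⟩
  map_mul x y := map_mul (Ideal.Quotient.mkₐ k M.nicholsIdeal) x y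
  map_one := rfl
  map_comul _ := rfl
  map_counit _ := rfl

theorem IsYD.nichols_isHopf {M : YDData k Γ V} (hM : M.IsYD) : M.nichols.IsHopf :=
  hM.tensorHopf_isHopf.of_surjective M.toNichols_isHopfHom M.toNichols_surjective hM.isAntipode
    fun x => by
      rw [toNichols_eq_zero_iff, toNichols_eq_zero_iff, hM.antipode_mem_nicholsIdeal]

end YDData

namespace YDData

variable {k Γ V W : Type*} [Field k] [CommGroup Γ] [AddCommGroup V] [Module k V]
  [AddCommGroup W] [Module k W]

/-! ### Twisting Yetter-Drinfeld modules and their tensor algebras -/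

/-- `M'` is the twist of the Yetter-Drinfeld module `M` by the bilinear form `σ`. -/
structure IsTwist (σ : Γ →* Γ →* kˣ) (M M' : YDData k Γ V) : Prop where
  coact : M'.coact = M.coact
  act : ∀ g h v, M.Deg h v → M'.act g v = ((σ g h * (σ h g)⁻¹ : kˣ) : k) • M.act g v

/-- Replacing the degree-dependent scalar by a linear map built from the coaction makes the twist
condition testable on a basis or on words. -/
theorem isTwist_of_act {σ : Γ →* Γ →* kˣ} {M M' : YDData k Γ V} (hco : M'.coact = M.coact)
    (hact : ∀ g, M'.act g = M.act g ∘ₗ (TensorProduct.lid k V).toLinearMap ∘ₗ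
      (linExt (fun h => σ g h * (σ h g)⁻¹)).rTensor V ∘ₗ M.coact) : IsTwist σ M M' where
  coact := hco
  act g h v hv := by
    unfold Deg at hv
    simp [hact, hv, linExt_single]

theorem IsTwist.deg_iff {σ : Γ →* Γ →* kˣ} {M M' : YDData k Γ V} (h : IsTwist σ M M') {g : Γ}
    {v : V} : M'.Deg g v ↔ M.Deg g v := by
  rw [Deg, Deg, h.coact]

theorem IsTwist.symm {σ : Γ →* Γ →* kˣ} {M M' : YDData k Γ V} (h : IsTwist σ M M') :
    IsTwist σ⁻¹ M' M where
  coact := h.coact.symm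
  act g g' v hv := by
    have : (σ⁻¹ g g' * (σ⁻¹ g' g)⁻¹) * (σ g g' * (σ g' g)⁻¹) = 1 := by
      simp only [MonoidHom.inv_apply, inv_inv]
      rw [mul_mul_mul_comm, inv_mul_cancel, mul_inv_cancel, mul_one]
    rw [h.act g g' v (h.deg_iff.1 hv), smul_smul, ← Units.val_mul, this, Units.val_one, one_smul]

theorem IsTwist.tensorAlgebra_coact {σ : Γ →* Γ →* kˣ} {M M' : YDData k Γ V}
    (h : IsTwist σ M M') : M'.tensorAlgebra.coact = M.tensorAlgebra.coact := by
  simp only [YDData.tensorAlgebra, h.coact]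

theorem IsTwist.tensorAlgebra {σ : Γ →* Γ →* kˣ} {M M' : YDData k Γ V} (hM : M.Homog)
    (h : IsTwist σ M M') : IsTwist σ M.tensorAlgebra M'.tensorAlgebra := by
  refine isTwist_of_act h.tensorAlgebra_coact fun g => ?_
  refine word_ext hM ?_ fun g' v h' x hv hx ih => ?_
  · have := M.deg_tensorAlgebra_one
    unfold Deg at this
    simp [this, tensorAlgebra_act_one, linExt_single]
  · have h1 := hv.ι.mul hx
    unfold Deg at h1 hx
    simp only [LinearMap.comp_apply, h1, hx, LinearMap.rTensor_tmul, linExt_single,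
      LinearEquiv.coe_coe, TensorProduct.lid_tmul, map_smul] at ih ⊢
    rw [tensorAlgebra_act_mul, tensorAlgebra_act_ι, ih, h.act g g' v hv, map_smul,
      tensorAlgebra_act_mul, tensorAlgebra_act_ι, smul_mul_smul_comm, ← Units.val_mul]
    congr 2
    -- The scalar `σ(g, h) σ(h, g)⁻¹` is multiplicative in `h`, so the twisted action is again by
    -- algebra automorphisms.
    simp only [map_mul, MonoidHom.mul_apply, mul_inv]
    rw [mul_mul_mul_comm]

/-! ### The twisting isomorphism on tensor algebras -/

/-- The isomorphism from the tensor algebra of the twist of `V` to the twist of `T(V)`: it is the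
identity on `V`, and `v x ↦ σ(g, h) v F(x)` for `v ∈ V` and `x` of degrees `g` and `h`. -/
def twistMap (M : YDData k Γ V) (σ : Γ →* Γ →* kˣ) : TensorAlgebra k V →ₗ[k] TensorAlgebra k V :=
  LinearMap.applyₗ 1 ∘ₗ (TensorAlgebra.lift k (A := Module.End k (TensorAlgebra k V))
    (TensorProduct.curry (LinearMap.mul' k (TensorAlgebra k V) ∘ₗ
      M.tensorAlgebra.scale σ) ∘ₗ TensorAlgebra.ι k)).toLinearMap

theorem twistMap_one (M : YDData k Γ V) (σ : Γ →* Γ →* kˣ) : M.twistMap σ 1 = 1 := by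
  simp [twistMap]

theorem twistMap_ι_mul_of_deg (M : YDData k Γ V) (σ : Γ →* Γ →* kˣ) {g h : Γ} {v : V}
    {x : TensorAlgebra k V} (hv : M.Deg g v) (hx : M.tensorAlgebra.Deg h (M.twistMap σ x)) :
    M.twistMap σ (TensorAlgebra.ι k v * x) =
      (σ g h : k) • (TensorAlgebra.ι k v * M.twistMap σ x) := by
  unfold twistMap at *
  simp only [LinearMap.comp_apply, AlgHom.toLinearMap_apply, map_mul, TensorAlgebra.lift_ι_apply,
    LinearMap.applyₗ_apply_apply, Module.End.mul_apply] at hx ⊢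
  simp [scale_tmul _ _ hv.ι hx]

variable {M M' : YDData k Γ V} {σ : Γ →* Γ →* kˣ}

theorem IsYD.deg_twistMap (hM : M.IsYD) {g : Γ} {x : TensorAlgebra k V}
    (hx : M.tensorAlgebra.Deg g x) : M.tensorAlgebra.Deg g (M.twistMap σ x) := by
  refine hM.deg_map (M.twistMap_one σ) (fun g v h x hv hx ih => ?_) hx
  rw [M.twistMap_ι_mul_of_deg σ hv ih]
  exact (hv.ι.mul ih).smul _

theorem IsYD.twistMap_ι_mul (hM : M.IsYD) (σ : Γ →* Γ →* kˣ) {g h : Γ} {v : V}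
    {x : TensorAlgebra k V} (hv : M.Deg g v) (hx : M.tensorAlgebra.Deg h x) :
    M.twistMap σ (TensorAlgebra.ι k v * x) =
      (σ g h : k) • (TensorAlgebra.ι k v * M.twistMap σ x) :=
  M.twistMap_ι_mul_of_deg σ hv (hM.deg_twistMap hx)

theorem IsYD.twistMap_inv_twistMap (hM : M.IsYD) (σ : Γ →* Γ →* kˣ) (x : TensorAlgebra k V) :
    M.twistMap σ⁻¹ (M.twistMap σ x) = x := by
  refine LinearMap.congr_fun (f := M.twistMap σ⁻¹ ∘ₗ M.twistMap σ) (g := LinearMap.id) ?_ x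
  refine word_ext hM.homog (by simp [twistMap_one]) fun g v h x hv hx ih => ?_
  simp only [LinearMap.comp_apply, LinearMap.id_apply] at ih ⊢
  rw [hM.twistMap_ι_mul σ hv hx, map_smul, hM.twistMap_ι_mul σ⁻¹ hv (hM.deg_twistMap hx), ih,
    smul_smul, ← Units.val_mul]
  simp

theorem IsYD.twistMap_twistMap_inv (hM : M.IsYD) (σ : Γ →* Γ →* kˣ) (x : TensorAlgebra k V) :
    M.twistMap σ (M.twistMap σ⁻¹ x) = x := by
  simpa using hM.twistMap_inv_twistMap σ⁻¹ x

theorem IsYD.twistMap_surjective (hM : M.IsYD) (σ : Γ →* Γ →* kˣ) :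
    Function.Surjective (M.twistMap σ) :=
  fun x => ⟨_, hM.twistMap_twistMap_inv σ x⟩

theorem IsYD.twistMap_mem_pow (hM : M.IsYD) (σ : Γ →* Γ →* kˣ) {n : ℕ} {x : TensorAlgebra k V}
    (hx : x ∈ LinearMap.range (TensorAlgebra.ι k (M := V)) ^ n) :
    M.twistMap σ x ∈ LinearMap.range (TensorAlgebra.ι k (M := V)) ^ n := by
  refine mem_pow_of_word hM.homog (M.twistMap_one σ) (fun n g v h x hv hx ih => ?_) hx
  rw [hM.twistMap_ι_mul σ hv hx, pow_succ']
  exact Submodule.smul_mem _ _ (Submodule.mul_mem_mul ⟨v, rfl⟩ ih)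

theorem IsYD.twistMap_act (hM : M.IsYD) (σ : Γ →* Γ →* kˣ) (g : Γ) (x : TensorAlgebra k V) :
    M.twistMap σ (M.tensorAlgebra.act g x) = M.tensorAlgebra.act g (M.twistMap σ x) := by
  refine LinearMap.congr_fun (f := M.twistMap σ ∘ₗ M.tensorAlgebra.act g)
    (g := M.tensorAlgebra.act g ∘ₗ M.twistMap σ) ?_ x
  refine word_ext hM.homog (by simp [tensorAlgebra_act_one, twistMap_one])
    fun h v h' x hv hx ih => ?_
  simp only [LinearMap.comp_apply] at ih ⊢
  rw [tensorAlgebra_act_mul, tensorAlgebra_act_ι,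
    hM.twistMap_ι_mul σ (hM.deg_act g hv) (hM.tensorAlgebra.deg_act g hx), ih,
    hM.twistMap_ι_mul σ hv hx, map_smul, tensorAlgebra_act_mul, tensorAlgebra_act_ι]

/-- Induction on the length of `x`; moving one letter from `x y` into `x` uses the 2-cocycle
identity for `σ`. -/
theorem IsYD.twistMap_mul (hM : M.IsYD) (σ : Γ →* Γ →* kˣ) {g h : Γ} {x y : TensorAlgebra k V}
    (hx : M.tensorAlgebra.Deg g x) (hy : M.tensorAlgebra.Deg h y) :
    M.twistMap σ (x * y) = (σ g h : k) • (M.twistMap σ x * M.twistMap σ y) := by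
  have hFy := hM.deg_twistMap (σ := σ) hy
  have key : M.twistMap σ ∘ₗ LinearMap.mulRight k y = LinearMap.mul' k (TensorAlgebra k V) ∘ₗ
      M.tensorAlgebra.scale σ ∘ₗ
      (TensorProduct.mk k _ _).flip (M.twistMap σ y) ∘ₗ M.twistMap σ := by
    refine word_ext hM.homog ?_ fun g v h' x hv hx ih => ?_
    · simp [twistMap_one, scale_tmul _ _ M.deg_tensorAlgebra_one hFy]
    · have h1 := hM.deg_twistMap (σ := σ) hx
      have h2 := hM.deg_twistMap (σ := σ) (hv.ι.mul hx)
      simp only [LinearMap.comp_apply, LinearMap.flip_apply, TensorProduct.mk_apply,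
        scale_tmul _ _ h1 hFy, scale_tmul _ _ h2 hFy, LinearMap.mulRight_apply,
        LinearMap.mul'_apply, map_smul] at ih ⊢
      rw [mul_assoc, hM.twistMap_ι_mul σ hv (hx.mul hy), ih, hM.twistMap_ι_mul σ hv hx,
        mul_smul_comm, smul_smul, smul_mul_assoc, smul_smul, ← Units.val_mul, ← Units.val_mul,
        mul_assoc]
      -- What remains is `σ(g, h' h) σ(h', h) = σ(g h', h) σ(g, h')`, a consequence of bilinearity.
      congr 2
      simp only [map_mul, MonoidHom.mul_apply]
      rw [mul_assoc, mul_comm]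
  have := LinearMap.congr_fun key x
  simpa [scale_tmul _ _ (hM.deg_twistMap (σ := σ) hx) hFy] using this

/-- Multiplication by `χ(g)` in degree `g`. -/
def degScale (M : YDData k Γ V) (χ : Γ → kˣ) : V →ₗ[k] V :=
  (TensorProduct.lid k V).toLinearMap ∘ₗ (linExt χ).rTensor V ∘ₗ M.coact

theorem degScale_apply (χ : Γ → kˣ) {g : Γ} {v : V} (hv : M.Deg g v) :
    M.degScale χ v = (χ g : k) • v := by
  unfold Deg at hv
  simp [degScale, hv, linExt_single]

theorem Homog.scale_scale_inv (hM : M.Homog) (σ : Γ →* Γ →* kˣ) (z : V ⊗[k] V) :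
    M.scale σ (M.scale σ⁻¹ z) = z := by
  refine LinearMap.congr_fun (f := M.scale σ ∘ₗ M.scale σ⁻¹) (g := LinearMap.id) ?_ z
  refine hM.ext₂ hM fun g v hv h w hw => ?_
  simp only [LinearMap.comp_apply, LinearMap.id_apply]
  rw [scale_tmul _ _ hv hw, map_smul, scale_tmul _ _ hv hw, smul_smul, ← Units.val_mul]
  simp

theorem IsTwist.scale_tensorComul_twistMap (h : IsTwist σ M M') (hM : M.IsYD) (hM' : M'.IsYD)
    (x : TensorAlgebra k V) :
    M.tensorAlgebra.scale σ⁻¹ (M.tensorComul (M.twistMap σ x)) =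
      TensorProduct.map (M.twistMap σ) (M.twistMap σ) (M'.tensorComul x) := by
  have hT := hM.tensorAlgebra
  have hTw := h.tensorAlgebra hM.homog
  refine LinearMap.congr_fun (f := M.tensorAlgebra.scale σ⁻¹ ∘ₗ M.tensorComul ∘ₗ M.twistMap σ)
    (g := TensorProduct.map (M.twistMap σ) (M.twistMap σ) ∘ₗ M'.tensorComul) ?_ x
  refine word_ext hM.homog ?_ fun g v h' x hv hx ih => ?_
  · have h1 := M.deg_tensorAlgebra_one
    simp [twistMap_one, tensorComul_one, scale_tmul _ _ h1 h1]
  simp only [LinearMap.comp_apply] at ih ⊢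
  -- `degScale (σ g)` supplies the factor `σ(g, deg x)` that `twistMap` puts on `v x`, since `Δ x`
  -- has the degree of `x`. On `a ⊗ b` of degrees `α`, `β`, what is left is `σ(g, α)` on the first
  -- summand and `σ(g, α) σ(α, g)⁻¹ σ(g, β)` on the second, the latter accounting for the twisted
  -- action on `a` and for `twistMap` on `v b`.
  have key : M.tensorAlgebra.scale σ⁻¹ ∘ₗ M.primMul g v ∘ₗ M.tensorAlgebra.scale σ ∘ₗ
      TensorProduct.map (M.twistMap σ) (M.twistMap σ) ∘ₗ
        (M'.tensorAlgebra.tensor M'.tensorAlgebra).degScale (σ g) =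
      TensorProduct.map (M.twistMap σ) (M.twistMap σ) ∘ₗ M'.primMul g v := by
    refine hT.homog.ext₂ hT.homog fun α a ha β b hb => ?_
    have hFa := hM.deg_twistMap (σ := σ) ha
    have hFb := hM.deg_twistMap (σ := σ) hb
    simp only [LinearMap.comp_apply]
    rw [degScale_apply _ ((hTw.deg_iff.2 ha).tmul (hTw.deg_iff.2 hb)), primMul_tmul,
      hTw.act g α a ha]
    simp only [map_smul, map_add, TensorProduct.map_tmul, ← TensorProduct.smul_tmul',
      scale_tmul _ _ hFa hFb, primMul_tmul, hM.twistMap_ι_mul σ hv ha,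
      hM.twistMap_ι_mul σ hv hb, hM.twistMap_act, scale_tmul _ _ (hv.ι.mul hFa) hFb,
      scale_tmul _ _ (hT.deg_act g hFa) (hv.ι.mul hFb), smul_add, smul_smul,
      TensorProduct.tmul_smul, ← Units.val_mul]
    congr 3 <;>
    · simp only [map_mul, MonoidHom.mul_apply, MonoidHom.inv_apply, Units.ext_iff,
        Units.val_mul, Units.val_inv_eq_inv_val]
      field_simp
  have hdeg := hM'.tensorComul_isHom.deg (hTw.deg_iff.2 hx)
  rw [hM.twistMap_ι_mul σ hv hx, map_smul, hM.tensorComul_ι_mul hv,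
    hM'.tensorComul_ι_mul (h.deg_iff.2 hv)]
  have h1 := LinearMap.congr_fun key (M'.tensorComul x)
  simp only [LinearMap.comp_apply] at h1
  rw [degScale_apply _ hdeg, map_smul, ← ih, map_smul, hT.homog.scale_scale_inv] at h1
  rw [← h1, map_smul, map_smul, map_smul]

theorem IsTwist.twistMap_isHopfHom (h : IsTwist σ M M') (hM : M.IsYD) (hM' : M'.IsYD) :
    M'.tensorHopf.IsHopfHom (M.tensorHopf.twist σ) (M.twistMap σ) where
  isHom := by
    have hTw := h.tensorAlgebra hM.homog
    refine Homog.isHom (M := M'.tensorHopf.toYDData) (N := (M.tensorHopf.twist σ).toYDData)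
      hM'.tensorAlgebra.homog (fun g h' x hx => ?_) fun g x hx => ?_
    · have hx' := hTw.deg_iff.1 hx
      have h1 := M.tensorHopf.twist_act σ g (hM.deg_twistMap (σ := σ) hx')
      rw [h1]
      refine (congrArg (M.twistMap σ) (hTw.act g h' x hx')).trans ?_
      rw [map_smul, hM.twistMap_act]
      rfl
    · exact hM.deg_twistMap (hTw.deg_iff.1 hx)
  map_mul x y := by
    refine LinearMap.congr_fun (f := M.twistMap σ ∘ₗ LinearMap.mul' k (TensorAlgebra k V))
      (g := LinearMap.mul' k (TensorAlgebra k V) ∘ₗ M.tensorAlgebra.scale σ ∘ₗ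
        TensorProduct.map (M.twistMap σ) (M.twistMap σ)) ?_ (x ⊗ₜ y)
    refine hM.tensorAlgebra.homog.ext₂ hM.tensorAlgebra.homog fun g x hx h y hy => ?_
    simp [hM.twistMap_mul σ hx hy,
      scale_tmul _ _ (hM.deg_twistMap (σ := σ) hx) (hM.deg_twistMap (σ := σ) hy)]
  map_one := M.twistMap_one σ
  map_comul x := h.scale_tensorComul_twistMap hM hM' x
  map_counit x := by
    refine LinearMap.congr_fun
      (f := (TensorAlgebra.algebraMapInv (R := k)).toLinearMap ∘ₗ M.twistMap σ)
      (g := (TensorAlgebra.algebraMapInv (R := k)).toLinearMap) ?_ x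
    refine word_ext hM.homog (by simp [twistMap_one]) fun g v h x hv hx ih => ?_
    simp [hM.twistMap_ι_mul σ hv hx, algebraMapInv_ι]

/-! ### Twisting the defining ideal and the Nichols algebra -/

theorem IsTwist.map_isNicholsSub (h : IsTwist σ M M') (hM : M.IsYD) (hM' : M'.IsYD)
    {I : Submodule k (TensorAlgebra k V)} (hI : M'.IsNicholsSub I) :
    M.IsNicholsSub (I.map (M.twistMap σ)) := by
  have hTw := h.tensorAlgebra hM.homog
  have hT := hM.tensorAlgebra
  have hI' : M.tensorAlgebra.HomogSub (I.map (M.twistMap σ)) :=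
    hI.homog.map fun g x hx => hM.deg_twistMap (hTw.deg_iff.1 hx)
  refine hI.map hM' (hM.twistMap_surjective σ) (fun n x hx => hM.twistMap_mem_pow σ hx)
    (fun g x hx => hM.deg_twistMap (hTw.deg_iff.1 hx)) (fun g h' x hx => ?_)
    (fun g b h' x hb hx hxI => ?_) (fun g b h' x hb hx hxI => ?_) fun x hx => ?_
  · exact ⟨_, (hM.twistMap_act σ g x).symm.trans
      ((congrArg (M.twistMap σ) (hTw.symm.act g h' x hx)).trans (map_smul _ _ _))⟩
  · have h1 := hM.twistMap_mul σ (hTw.deg_iff.1 hb) (hTw.deg_iff.1 hx)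
    rw [← Units.smul_def, eq_comm, ← eq_inv_smul_iff, Units.smul_def] at h1
    rw [h1]
    exact Submodule.smul_mem _ _ ⟨_, hI.mul_left b x hxI, rfl⟩
  · have h1 := hM.twistMap_mul σ (hTw.deg_iff.1 hx) (hTw.deg_iff.1 hb)
    rw [← Units.smul_def, eq_comm, ← eq_inv_smul_iff, Units.smul_def] at h1
    rw [h1]
    exact Submodule.smul_mem _ _ ⟨_, hI.mul_right b x hxI, rfl⟩
  -- By the preceding formula `Δ F = scale_σ (F ⊗ F) Δ'`, and scaling preserves a coideal subspace
  -- that comes from a homogeneous `I`.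
  · rw [← hT.homog.scale_scale_inv σ (M.tensorComul _), h.scale_tensorComul_twistMap hM hM']
    refine hI'.coideal_le hT.homog
      (P := (coideal (I.map (M.twistMap σ))).comap (M.tensorAlgebra.scale σ))
      (fun g a h b ha hb hab => ?_) (map_mem_coideal (hI.comul_mem x hx))
    rw [Submodule.mem_comap, scale_tmul _ _ ha hb]
    refine Submodule.smul_mem _ _ ?_
    rcases hab with hab | hab
    · exact tmul_mem_coideal_left hab _
    · exact tmul_mem_coideal_right _ hab

/-- The map depends only on the coaction, which the twist does not change. Thus the inverse of the
map for `σ` is the map for `σ⁻¹` attached to `M'`, and the converse inclusion of ideals is the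
direct one applied to `IsTwist.symm`. -/
theorem IsTwist.twistMap_congr (h : IsTwist σ M M') (τ : Γ →* Γ →* kˣ) :
    M'.twistMap τ = M.twistMap τ := by
  simp only [twistMap, scale, h.tensorAlgebra_coact]

theorem IsTwist.twistMap_mem_nicholsIdeal (h : IsTwist σ M M') (hM : M.IsYD) (hM' : M'.IsYD)
    (x : TensorAlgebra k V) : M.twistMap σ x ∈ M.nicholsIdeal ↔ x ∈ M'.nicholsIdeal := by
  constructor <;> intro hx
  · rw [← hM.twistMap_inv_twistMap σ x, ← h.twistMap_congr]
    exact map_mem_nicholsIdeal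
      (fun I hI => h.symm.map_isNicholsSub hM' hM (hI.isNicholsSub hM)) hx
  · exact map_mem_nicholsIdeal (fun I hI => h.map_isNicholsSub hM hM' (hI.isNicholsSub hM')) hx

/-- The target `B(M)_σ` is a quotient of `T(M')` by the defining ideal of `B(M')`. Its Hopf axioms
are thus inherited from `T(M')`, with no separate proof that twisting preserves Hopf algebras. -/
theorem IsTwist.nichols (h : IsTwist σ M M') (hM : M.IsYD) (hM' : M'.IsYD) :
    (M.nichols.twist σ).IsHopf ∧ M'.nichols.Isomorphic (M.nichols.twist σ) := by
  have h1 : (M.tensorHopf.twist σ).IsHopfHom (M.nichols.twist σ) M.toNichols :=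
    M.toNichols_isHopfHom.twist hM.tensorHopf_isHopf.isYD.homog σ
  have h2 := h1.comp (h.twistMap_isHopfHom hM hM')
  have hs : Function.Surjective (M.toNichols ∘ₗ M.twistMap σ) := by
    rw [LinearMap.coe_comp]
    exact M.toNichols_surjective.comp (hM.twistMap_surjective σ)
  have hker : ∀ x, (M.toNichols ∘ₗ M.twistMap σ) x = 0 ↔ x ∈ M'.nicholsIdeal := fun x => by
    rw [LinearMap.comp_apply, toNichols_eq_zero_iff, h.twistMap_mem_nicholsIdeal hM hM']
  constructor
  · refine hM'.tensorHopf_isHopf.of_surjective h2 hs hM'.isAntipode fun x => ?_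
    rw [hker, hker, hM'.antipode_mem_nicholsIdeal]
  · refine HopfData.Isomorphic.of_ker_eq M'.toNichols_isHopfHom h2 M'.toNichols_surjective hs ?_
    ext x
    rw [LinearMap.mem_ker, LinearMap.mem_ker, hker, toNichols_eq_zero_iff]

end YDData

/-! ### The cocycle defined by a bilinear form -/

section Cocycle

variable {k Γ : Type*} [Field k] [CommGroup Γ]

theorem counit_single_one {Γ : Type*} (g : Γ) :
    Coalgebra.counit (R := k) (MonoidAlgebra.single g (1 : k)) = 1 := by
  simp

/-- On group-like elements convolution is pointwise multiplication, so the cocycle conditions become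
identities for `σ` on `Γ`. -/
theorem convMul_apply_of_comul {C : Type*} [AddCommGroup C] [Module k C] [Coalgebra k C]
    (φ ψ : WithConv (C →ₗ[k] k)) {c : C} (hc : Coalgebra.comul (R := k) c = c ⊗ₜ c) :
    (φ * ψ) c = φ c * ψ c := by
  rw [LinearMap.convMul_apply, hc]
  simp

theorem isInvertibleTwoCocycle_bilinExt (σ : Γ →* Γ →* kˣ) :
    IsInvertibleTwoCocycle (bilinExt σ) := by
  have h2 : ∀ g h : Γ, Coalgebra.comul (R := k) (MonoidAlgebra.single g (1 : k) ⊗ₜ[k]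
      MonoidAlgebra.single h (1 : k)) =
      (MonoidAlgebra.single g (1 : k) ⊗ₜ[k] MonoidAlgebra.single h (1 : k)) ⊗ₜ
        (MonoidAlgebra.single g (1 : k) ⊗ₜ[k] MonoidAlgebra.single h (1 : k)) := fun g h => by
    simp [TensorProduct.comul_tmul]
  have h3 : ∀ g h l : Γ, Coalgebra.comul (R := k) (MonoidAlgebra.single g (1 : k) ⊗ₜ[k]
      (MonoidAlgebra.single h (1 : k) ⊗ₜ[k] MonoidAlgebra.single l (1 : k))) =
      (MonoidAlgebra.single g (1 : k) ⊗ₜ[k]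
        (MonoidAlgebra.single h (1 : k) ⊗ₜ[k] MonoidAlgebra.single l (1 : k))) ⊗ₜ
      (MonoidAlgebra.single g (1 : k) ⊗ₜ[k]
        (MonoidAlgebra.single h (1 : k) ⊗ₜ[k] MonoidAlgebra.single l (1 : k))) := fun g h l => by
    simp [TensorProduct.comul_tmul, h2]
  have hinv : ∀ τ : Γ →* Γ →* kˣ,
      WithConv.toConv (bilinExt τ) * WithConv.toConv (bilinExt τ⁻¹) = 1 := fun τ => by
    apply WithConv.ofConv_injective
    refine TensorProduct.ext (MonoidAlgebra.lhom_ext' fun g => LinearMap.ext_ring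
      (MonoidAlgebra.lhom_ext' fun h => LinearMap.ext_ring ?_))
    refine (convMul_apply_of_comul (WithConv.toConv (bilinExt τ))
      (WithConv.toConv (bilinExt τ⁻¹)) (h2 g h)).trans ?_
    simp [bilinExt_single]
  refine ⟨?_, fun x => ?_, fun x => ?_, ?_⟩
  · exact IsUnit.of_mul_eq_one _ (hinv σ)
  · refine LinearMap.congr_fun (f := bilinExt σ ∘ₗ (TensorProduct.mk k _ _).flip 1)
      (g := Coalgebra.counit) (MonoidAlgebra.lhom_ext' fun g => LinearMap.ext_ring ?_) x
    simp [MonoidAlgebra.one_def, bilinExt_single]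
  · refine LinearMap.congr_fun (f := bilinExt σ ∘ₗ TensorProduct.mk k _ _ 1)
      (g := Coalgebra.counit) (MonoidAlgebra.lhom_ext' fun g => LinearMap.ext_ring ?_) x
    simp [MonoidAlgebra.one_def, bilinExt_single]
  · apply WithConv.ofConv_injective
    refine TensorProduct.ext (MonoidAlgebra.lhom_ext' fun g => LinearMap.ext_ring
      (TensorProduct.ext (MonoidAlgebra.lhom_ext' fun h => LinearMap.ext_ring
        (MonoidAlgebra.lhom_ext' fun l => LinearMap.ext_ring ?_))))
    refine (convMul_apply_of_comul _ _ (h3 g h l)).trans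
      (Eq.trans ?_ (convMul_apply_of_comul _ _ (h3 g h l)).symm)
    simp only [LinearMap.comp_apply, LinearEquiv.coe_coe,
      TensorProduct.assoc_symm_tmul, TensorProduct.map_tmul, LinearMap.mul'_apply,
      LinearMap.rTensor_tmul, LinearMap.lTensor_tmul, MonoidAlgebra.single_mul_single,
      bilinExt_single, counit_single_one, mul_one, one_mul, map_mul, MonoidHom.mul_apply,
      Units.val_mul]
    ring

end Cocycle

/-! ### Homomorphisms from `(ℤ/f)^θ` -/

section GenHom

variable {A : Type*} [CommGroup A] {f θ : ℕ}

/-- The homomorphism `ℤ/f → A` that maps the generator to an element `u` with `u ^ f = 1`. -/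
def zmodHom (u : A) (hu : u ^ f = 1) : Multiplicative (ZMod f) →* A :=
  AddMonoidHom.toMultiplicativeLeft (ZMod.lift f
    ⟨zmultiplesHom (Additive A) (Additive.ofMul u), by
      simp [← ofMul_pow, hu]⟩)

theorem zmodHom_one (u : A) (hu : u ^ f = 1) :
    zmodHom u hu (Multiplicative.ofAdd 1) = u := by
  have := ZMod.lift_coe f (⟨zmultiplesHom (Additive A) (Additive.ofMul u), by
      simp [← ofMul_pow, hu]⟩ : { φ : ℤ →+ Additive A // φ f = 0 }) 1
  simp only [Int.cast_one] at this
  simp [zmodHom, this]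

/-- The homomorphism `(ℤ/f)^θ → A` that maps the canonical generators to elements `u i` with
`u i ^ f = 1`. -/
def genHom (u : Fin θ → A) (hu : ∀ i, u i ^ f = 1) : BPGroup f θ →* A :=
  ∏ i, (zmodHom (u i) (hu i)).comp (Pi.evalMonoidHom _ i)

theorem genHom_gen (u : Fin θ → A) (hu : ∀ i, u i ^ f = 1) (i : Fin θ) :
    genHom u hu (gen f i) = u i := by
  classical
  rw [genHom, MonoidHom.finsetProd_apply, Finset.prod_eq_single i]
  · simp [gen, zmodHom_one]
  · intro j _ hj
    simp [gen, hj]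
  · simp

theorem hom_ext_gen {φ ψ : BPGroup f θ →* A} (h : ∀ i, φ (gen f i) = ψ (gen f i)) : φ = ψ := by
  refine MonoidHom.functions_ext' A φ ψ fun i => ?_
  refine MonoidHom.ext fun x => ?_
  obtain ⟨n, hn⟩ := ZMod.intCast_surjective (Multiplicative.toAdd x)
  have hx : x = Multiplicative.ofAdd (1 : ZMod f) ^ n := by
    rw [← ofAdd_zsmul, zsmul_one, hn, ofAdd_toAdd]
  have h1 := h i
  simp only [gen] at h1
  subst hx
  simp [map_zpow, h1]

end GenHom

/-! ### The standard realizations -/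

section Realization

variable {k : Type*} [Field k] {p t θ : ℕ} [CharP k p] {f : ℕ}

theorem BPSpace.hom_ext {W : Type*} [AddCommMonoid W] [Module k W] {φ ψ : BPSpace k t θ →ₗ[k] W}
    (hx : ∀ i : Fin θ, φ (vx i) = ψ (vx i)) (hy : ∀ j : Fin t, φ (vy j) = ψ (vy j)) : φ = ψ := by
  refine Finsupp.lhom_ext' fun b => LinearMap.ext_ring ?_
  cases b with
  | inl i => exact hx i
  | inr j => exact hy j

/-- The character of `(ℤ/f)^θ` with `g_i ↦ q_ij`. -/
def bpChar (q : Fin θ → Fin θ → kˣ) (hqf : ∀ i j, orderOf (q i j) ∣ f) (j : Fin θ) :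
    BPGroup f θ →* kˣ :=
  genHom (fun i => q i j) fun i => orderOf_dvd_iff_pow_eq_one.1 (hqf i j)

/-- The homomorphism from `(ℤ/f)^θ` to the additive group of `k` with `g_i ↦ s_ij`. -/
def bpShear (h : t < θ) (a : {i : Fin θ // t ≤ i.val} → Fin t → ZMod p) (hpf : p ∣ f)
    (j : Fin t) : BPGroup f θ →* Multiplicative k :=
  genHom (fun i => Multiplicative.ofAdd (shear k h a i j)) fun i => by
    -- The target is the additive group of `k`, where `f` acts as zero because `p ∣ f`.
    rw [← ofAdd_nsmul, nsmul_eq_mul, (CharP.cast_eq_zero_iff k p f).2 hpf, zero_mul, ofAdd_zero]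

/-- The standard realization of `V(q, a)` over `(ℤ/f)^θ`. -/
def bpYD (h : t < θ) (q : Fin θ → Fin θ → kˣ) (a : {i : Fin θ // t ≤ i.val} → Fin t → ZMod p)
    (hpf : p ∣ f) (hqf : ∀ i j, orderOf (q i j) ∣ f) :
    YDData k (BPGroup f θ) (BPSpace k t θ) where
  act g := Finsupp.linearCombination k (Sum.elim
    (fun i => (bpChar q hqf i g : k) • (vx i : BPSpace k t θ))
    (fun j => (bpChar q hqf (Fin.castLE h.le j) g : k) •
      (vy j + (bpShear (k := k) h a hpf j g).toAdd • vx (Fin.castLE h.le j))))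
  coact := Finsupp.linearCombination k (Sum.elim
    (fun i => MonoidAlgebra.single (gen f i) 1 ⊗ₜ vx i)
    (fun j => MonoidAlgebra.single (gen f (Fin.castLE h.le j)) 1 ⊗ₜ vy j))

variable (h : t < θ) (q : Fin θ → Fin θ → kˣ) (a : {i : Fin θ // t ≤ i.val} → Fin t → ZMod p)
    (hpf : p ∣ f) (hqf : ∀ i j, orderOf (q i j) ∣ f)

theorem bpYD_act_vx (g : BPGroup f θ) (i : Fin θ) :
    (bpYD h q a hpf hqf).act g (vx i) = (bpChar q hqf i g : k) • (vx i : BPSpace k t θ) := by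
  simp [bpYD, vx]

theorem bpYD_act_vy (g : BPGroup f θ) (j : Fin t) :
    (bpYD h q a hpf hqf).act g (vy j) = (bpChar q hqf (Fin.castLE h.le j) g : k) •
      (vy j + (bpShear (k := k) h a hpf j g).toAdd • vx (Fin.castLE h.le j) : BPSpace k t θ) := by
  simp [bpYD, vy]

theorem bpYD_deg_vx (i : Fin θ) : (bpYD h q a hpf hqf).Deg (gen f i) (vx i) := by
  simp [YDData.Deg, bpYD, vx]

theorem bpYD_deg_vy (j : Fin t) :
    (bpYD h q a hpf hqf).Deg (gen f (Fin.castLE h.le j)) (vy j) := by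
  simp [YDData.Deg, bpYD, vy]

/-- On the plane spanned by `x_j` and `y_j` the action is a character times a unipotent matrix with
entry `s_j(g)`; composing such matrices multiplies the characters and adds the entries. The two
vectors share a degree, so the shear respects the grading. -/
theorem bpYD_isYD : (bpYD h q a hpf hqf).IsYD := by
  refine YDData.isYD_of_homog ?_ ?_ (fun g g' => ?_) fun g => ?_
  · unfold YDData.Homog
    rw [eq_top_iff, ← (Finsupp.basisSingleOne (R := k) (ι := Fin θ ⊕ Fin t)).span_eq]
    refine Submodule.span_mono ?_
    rintro _ ⟨b, rfl⟩
    rw [Finsupp.coe_basisSingleOne]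
    cases b with
    | inl i => exact ⟨_, bpYD_deg_vx h q a hpf hqf i⟩
    | inr j => exact ⟨_, bpYD_deg_vy h q a hpf hqf j⟩
  · exact BPSpace.hom_ext (fun i => by simp [bpYD_act_vx]) fun j => by simp [bpYD_act_vy]
  · refine BPSpace.hom_ext (fun i => ?_) fun j => ?_
    · simp only [LinearMap.comp_apply, bpYD_act_vx, map_smul, map_mul, Units.val_mul]
      module
    · simp only [LinearMap.comp_apply, bpYD_act_vx, bpYD_act_vy, map_smul, map_add, map_mul,
        Units.val_mul, toAdd_mul]
      module
  · refine BPSpace.hom_ext (fun i => ?_) fun j => ?_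
    · have h1 := bpYD_deg_vx h q a hpf hqf i
      unfold YDData.Deg at h1
      simp [bpYD_act_vx, h1]
    · have h1 := bpYD_deg_vy h q a hpf hqf j
      have h2 := bpYD_deg_vx h q a hpf hqf (Fin.castLE h.le j)
      unfold YDData.Deg at h1 h2
      simp [bpYD_act_vy, h1, h2, TensorProduct.tmul_add]

theorem bpYD_isStandardRealization :
    IsStandardRealization h q a (bpYD h q a hpf hqf) where
  isYD := bpYD_isYD h q a hpf hqf
  act_x i j := by rw [bpYD_act_vx, bpChar, genHom_gen]
  act_y i j := by rw [bpYD_act_vy, bpChar, genHom_gen, bpShear, genHom_gen, toAdd_ofAdd]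
  coact_x i := bpYD_deg_vx h q a hpf hqf i
  coact_y j := bpYD_deg_vy h q a hpf hqf j

variable {h q a} in
theorem IsStandardRealization.braiding_eq {M : YDData k (BPGroup f θ) (BPSpace k t θ)}
    (hM : IsStandardRealization h q a M) : M.braiding M = bpBraiding h q a := by
  refine TensorProduct.ext ?_
  apply BPSpace.hom_ext <;> intro i <;> apply BPSpace.hom_ext <;> intro j
  · have h1 := M.braiding_tmul M (hM.coact_x i) (vx j)
    rw [hM.act_x, ← TensorProduct.smul_tmul'] at h1
    simpa [bpBraiding, vx, bpBraidingBasis] using h1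
  · have h1 := M.braiding_tmul M (hM.coact_x i) (vy j)
    rw [hM.act_y, ← TensorProduct.smul_tmul'] at h1
    simpa [bpBraiding, vx, vy, bpBraidingBasis] using h1
  · have h1 := M.braiding_tmul M (hM.coact_y i) (vx j)
    rw [hM.act_x, ← TensorProduct.smul_tmul'] at h1
    simpa [bpBraiding, vx, vy, bpBraidingBasis] using h1
  · have h1 := M.braiding_tmul M (hM.coact_y i) (vy j)
    rw [hM.act_y, ← TensorProduct.smul_tmul'] at h1
    simpa [bpBraiding, vx, vy, bpBraidingBasis] using h1

/-- The bilinear form on `(ℤ/f)^θ` with `(g_i, g_j) ↦ u_ij`. -/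
def bpForm (u : Fin θ → Fin θ → kˣ) (hu : ∀ i j, u i j ^ f = 1) :
    BPGroup f θ →* BPGroup f θ →* kˣ :=
  -- The outer homomorphism takes values in the character group, where being killed by `f` can be
  -- checked on the generators.
  genHom (fun i => genHom (u i) (hu i)) fun i => hom_ext_gen fun j => by
    rw [MonoidHom.pow_apply, genHom_gen, hu, MonoidHom.one_apply]

theorem bpForm_gen (u : Fin θ → Fin θ → kˣ) (hu : ∀ i j, u i j ^ f = 1) (i j : Fin θ) :
    bpForm u hu (gen f i) (gen f j) = u i j := by
  rw [bpForm, genHom_gen, genHom_gen]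

/-- The characters on `x_j` and `y_j` are compared on generators. The unipotent part is the same on
both sides, as it depends only on `a`. -/
theorem bpYD_isTwist {q' : Fin θ → Fin θ → kˣ} (hqf' : ∀ i j, orderOf (q' i j) ∣ f)
    {σ : BPGroup f θ →* BPGroup f θ →* kˣ}
    (hσ : ∀ i j, σ (gen f i) (gen f j) * (σ (gen f j) (gen f i))⁻¹ * q i j = q' i j) :
    YDData.IsTwist σ (bpYD h q a hpf hqf) (bpYD h q' a hpf hqf') := by
  have hchar : ∀ (j : Fin θ) (g : BPGroup f θ),
      bpChar q' hqf' j g = σ g (gen f j) * (σ (gen f j) g)⁻¹ * bpChar q hqf j g := by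
    intro j
    have : bpChar q' hqf' j = σ.flip (gen f j) * (σ (gen f j))⁻¹ * bpChar q hqf j :=
      hom_ext_gen fun i => by
        simp only [MonoidHom.mul_apply, MonoidHom.inv_apply, MonoidHom.flip_apply]
        rw [bpChar, bpChar, genHom_gen, genHom_gen, hσ]
    exact fun g => DFunLike.congr_fun this g
  refine YDData.isTwist_of_act rfl fun g => BPSpace.hom_ext (fun i => ?_) fun j => ?_
  · have h1 := bpYD_deg_vx h q a hpf hqf i
    unfold YDData.Deg at h1
    simp only [LinearMap.comp_apply, h1, LinearMap.rTensor_tmul, linExt_single,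
      LinearEquiv.coe_coe, TensorProduct.lid_tmul, map_smul, bpYD_act_vx, smul_smul, hchar,
      Units.val_mul]
  · have h1 := bpYD_deg_vy h q a hpf hqf j
    unfold YDData.Deg at h1
    simp only [LinearMap.comp_apply, h1, LinearMap.rTensor_tmul, linExt_single,
      LinearEquiv.coe_coe, TensorProduct.lid_tmul, map_smul, bpYD_act_vy, smul_smul, hchar,
      Units.val_mul]

end Realization

end BraidedHopf

end

/-! ### The triangular form `σ` and the conclusion -/

theorem corollaryA6 {k : Type*} [Field k] (p : ℕ) [Fact p.Prime] [CharP k p] (hp : p ≠ 2)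
    (t θ : ℕ) (ht : 0 < t) (htθ : t < θ)
    (q q' : Fin θ → Fin θ → kˣ)
    (hq : ∀ i, q i i = 1) (hqq : ∀ i j, q i j * q j i = 1)
    (hq' : ∀ i, q' i i = 1) (hqq' : ∀ i j, q' i j * q' j i = 1)
    (a : {i : Fin θ // t ≤ i.val} → Fin t → ZMod p)
    (f : ℕ) (hf : 0 < f) (hpf : p ∣ f)
    (hqf : ∀ i j, orderOf (q i j) ∣ f) (hqf' : ∀ i j, orderOf (q' i j) ∣ f) :
    BraidedHopf.Realizable (BraidedHopf.BPGroup f θ) (BraidedHopf.bpBraiding htθ q a) ∧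
    BraidedHopf.Realizable (BraidedHopf.BPGroup f θ) (BraidedHopf.bpBraiding htθ q' a) ∧
    ∃ M M' : BraidedHopf.YDData k (BraidedHopf.BPGroup f θ) (BraidedHopf.BPSpace k t θ),
      BraidedHopf.IsStandardRealization htθ q a M ∧
      M.braiding M = BraidedHopf.bpBraiding htθ q a ∧
      BraidedHopf.IsStandardRealization htθ q' a M' ∧
      M'.braiding M' = BraidedHopf.bpBraiding htθ q' a ∧
      ∃ σ : BraidedHopf.BPGroup f θ →* BraidedHopf.BPGroup f θ →* kˣ,
        (∀ i j, σ (BraidedHopf.gen f i) (BraidedHopf.gen f j) =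
          if i ≤ j then q' i j * (q i j)⁻¹ else 1) ∧
        BraidedHopf.IsInvertibleTwoCocycle (BraidedHopf.bilinExt σ) ∧
        M.nichols.IsHopf ∧ M'.nichols.IsHopf ∧ (M.nichols.twist σ).IsHopf ∧
        M'.nichols.Isomorphic (M.nichols.twist σ) := by
  have hYD := BraidedHopf.bpYD_isStandardRealization htθ q a hpf hqf
  have hYD' := BraidedHopf.bpYD_isStandardRealization htθ q' a hpf hqf'
  have hpow : ∀ i j, q i j ^ f = 1 := fun i j => orderOf_dvd_iff_pow_eq_one.1 (hqf i j)
  have hpow' : ∀ i j, q' i j ^ f = 1 := fun i j => orderOf_dvd_iff_pow_eq_one.1 (hqf' i j)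
  have hu : ∀ i j, (if i ≤ j then q' i j * (q i j)⁻¹ else 1) ^ f = 1 := fun i j => by
    split_ifs
    · rw [mul_pow, inv_pow, hpow, hpow', inv_one, mul_one]
    · exact one_pow f
  have hσ := BraidedHopf.bpForm_gen _ hu
  have hqinv : ∀ i j, (q i j)⁻¹ = q j i := fun i j => inv_eq_of_mul_eq_one_right (hqq i j)
  have hqinv' : ∀ i j, (q' i j)⁻¹ = q' j i := fun i j => inv_eq_of_mul_eq_one_right (hqq' i j)
  have htw := BraidedHopf.bpYD_isTwist htθ q a hpf hqf hqf' (σ := BraidedHopf.bpForm _ hu)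
    fun i j => by
      rw [hσ, hσ]
      -- For `i < j` the scalar `q'_ij q_ij⁻¹` is supplied directly. On the diagonal everything is
      -- `1`. For `i > j` it is `(q'_ji q_ji⁻¹)⁻¹ q_ij = q'_ij q_ji q_ij = q'_ij`.
      rcases lt_trichotomy i j with hij | rfl | hij
      · rw [if_pos hij.le, if_neg hij.not_ge, inv_one, mul_one, inv_mul_cancel_right]
      · simp [hq, hq']
      · rw [if_neg hij.not_ge, if_pos hij.le, one_mul, mul_inv, inv_inv, hqinv', mul_assoc, hqq,
          mul_one]
  obtain ⟨htwist, hiso⟩ := htw.nichols hYD.isYD hYD'.isYD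
  exact ⟨⟨_, hYD.isYD, hYD.braiding_eq⟩, ⟨_, hYD'.isYD, hYD'.braiding_eq⟩, _, _, hYD,
    hYD.braiding_eq, hYD', hYD'.braiding_eq, _, hσ,
    BraidedHopf.isInvertibleTwoCocycle_bilinExt _, hYD.isYD.nichols_isHopf,
    hYD'.isYD.nichols_isHopf, htwist, hiso⟩
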